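/- Let $d\ge 1$, $n\ge 0$, let $u=(u_1,\dots,u_{d+1})\in\mathbb C^{d+1}$ with $u_{d+1}\neq 0$, and put $V_u(x)=\sum_{K=1}^{d+1}u_K\frac{x^K}{K}$. For $\vartheta=-\arg(u_{d+1})/(d+1)$ let $\mathcal S_k$ be the open sector $\left|\arg x-\vartheta-\frac{k\pi}{d+1}\right|<\frac{\pi}{2(d+1)}$, so that $\Re V_u\to+\infty$ in the even sectors. For $k=1,\dots,d$ let $\Gamma_k$ be a contour, parametrized by a Lipschitz map of $\mathbb R$ with $\Gamma_k(s)/|s|\to c_k^{-}$ as $s\to-\infty$ and $\Gamma_k(s)/|s|\to c_k^{+}$ as $s\to+\infty$, where $c_k^-\in\mathcal S_{2k-2}$ and $c_k^+\in\mathcal S_{2k}$. Let $\varkappa_1,\dots,\varkappa_d\in\mathbb C$, $\int_{\varkappa\Gamma}=\sum_k\varkappa_k\int_{\Gamma_k}$, and let $\mathcal L(q)=\int_{\varkappa\Gamma}e^{-V_u(x)}q(x)\,dx$ for polynomials $q$. Assume that the monic orthogonal polynomials $p_0,p_1,\dots$ of $\mathcal L$ exist: $\deg p_j=j$ and $\mathcal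 L(p_ip_j)=h_j\delta_{ij}$ with $h_j\ne0$. For $t=(t_1,\dots,t_{d+1})\in\mathbb C^{d+1}$ put $\xi_t(z)=\sum_{J=1}^{d+1}t_J\frac{z^J}{J}$ and $$\mathcal Z_n(t)=\int_{\varkappa\Gamma}dx_1\cdots\int_{\varkappa\Gamma}dx_n\prod_{i<j}(x_i-x_j)^2\,e^{-\sum_j V_{u+t}(x_j)}.$$ For an entire function $f$ let $f_{\ge n}$ be the part of its Taylor series at $0$ with exponents $\ge n$. Let $\mathcal H_n=\mathrm{span}\{z^j\}_{j<n}$, $\mathcal H_+=\mathrm{span}\{z^j\}_{j\ge n}$, and $w_0=\mathrm{span}\{p_j\}_{j\ge n}$. For a subspace $W$ of $\mathbb C[z]$, an admissible frame of $W$ is a basis $(w_j)_{j\ge0}$ of $W$ with $w_j$ monic of degree $n+j$. The KP tau function of $W$ (with respect to the splitting $\mathcal H_n+\mathcal H_+$) is $$\tau_W(t)=\lim_{N\to\infty}\det\Big([z^{n+i}]\,e^{\xi_t(z)}w_j(z)\Big)_{0\le i,j<N},$$ that is, the determinant of the projection to $\mathcal H_+$ of the frame of $W$ moved by the group element $\exp(\sum_J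 t_Jz^J/J)$ acting by multiplication, the infinite determinant being the limit of its finite truncations. Then: 1. $w_0$ belongs to the Grassmannian of subspaces commensurable with $\mathcal H_+$ (the projection $w_0\to\mathcal H_+$ is Fredholm, and in fact bijective), and $(p_{n+j})_{j\ge0}$ is an admissible frame of $w_0$. The integral $\mathcal Z_n(0)$ converges absolutely and is nonzero. 2. Let $t$ be such that $\Re\big((u_{d+1}+t_{d+1})c^{d+1}\big)>0$ for every $c\in\{c_k^\pm\}$. Then $\mathcal Z_n(t)$ converges absolutely. Let $\mathcal H_{+,t}$ be the space of entire functions $f$ that vanish to order at least $n$ at $0$ and for which $\int_{\Gamma_k}|f(x)\,x^m e^{-V_{u+t}(x)}|\,|dx|<\infty$ for all $k$ and all $m\ge 0$. Then the formula $$\widehat Kf(z)=\int_{\varkappa\Gamma}dw\,e^{-V_u(w)}K(z,w)f(w),\qquad K(z,w)=\sum_{j=0}^{n-1}\frac1{h_j}\big(e^{\xi_t(z)}p_j(z)\big)_{\ge n}\,p_j(w)\,e^{-\xi_t(w)},$$ defines a linear operator $\widehat K:\mathcal H_{+,t}\to\mathcal H_{+,t}$ of rank at most $n$, and its Fredholm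 determinant (the determinant of $1-\widehat K$ on the finite-dimensional range of $\widehat K$) is $$\det(1-\widehat K)=\frac{\mathcal Z_n(t)}{\mathcal Z_n(0)}.$$ 3. Suppose moreover that $|t_{d+1}|\,|c|^{d+1}<\Re\big(u_{d+1}c^{d+1}\big)$ for every $c\in\{c_k^\pm\}$ (that is, $|t_{d+1}|<|u_{d+1}|$ if the contours go to infinity along the bisectors of the sectors). Then the limit defining $\tau_{w_0}(t)$ exists in every admissible frame of $w_0$, in particular in the frame $(p_{n+j})$, and $$\tau_{w_0}(t)=\frac{\mathcal Z_n(t)}{\mathcal Z_n(0)}=\det(1-\widehat K).$$ Furthermore the monomials $z^{n+k}$, $k\ge 0$, lie in $\mathcal H_{+,t}$, and for all $i,k\ge0$ the coefficient of $z^{n+i}$ in $\widehat K z^{n+k}$ is the corresponding entry of the matrix $-B\,W_{n+}W_+^{-1}C^{-1}$ (given by a convergent series). Here, relative to the splitting $\mathcal H_n+\mathcal H_+$, the matrix $\begin{pmatrix}W_n&W_{n+}\\0&W_+\end{pmatrix}$ has the coefficients of the $p_j$ as its columns, and $\begin{pmatrix}A&0\\B&C\end{pmatrix}$ is the matrix of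 multiplication by $e^{\xi_t(z)}$ in the basis $1,z,z^2,\dots$. -/

import Mathlib

open Filter Topology MeasureTheory Polynomial

noncomputable section

namespace KPTau

/-! ### Potential, contours, moment functional, partition function -/

/-- `∑_{K=1}^{d+1} a_K x^K / K`.  With `a = u` this is the potential `V(x)`; with `a = t` it is the
exponent `∑_J t_J z^J / J` of the commuting flows, for `t = (t_1, …, t_{d+1}, 0, 0, …)`. -/
def potential (d : ℕ) (a : ℕ → ℂ) (x : ℂ) : ℂ :=
  ∑ K ∈ Finset.Icc 1 (d + 1), a K * x ^ K / (K : ℂ)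

/-- The open sector `S_k` of aperture `π/(d+1)` about the direction `ϑ + kπ/(d+1)`, where
`ϑ = -arg(u_{d+1})/(d+1)`, so that `Re V → +∞` in the even sectors. -/
def sector (d : ℕ) (u : ℕ → ℂ) (k : ℕ) : Set ℂ :=
  {x | ∃ r θ : ℝ, 0 < r ∧
    -Complex.arg (u (d + 1)) / (d + 1) + (2 * k - 1) * Real.pi / (2 * (d + 1)) < θ ∧
    θ < -Complex.arg (u (d + 1)) / (d + 1) + (2 * k + 1) * Real.pi / (2 * (d + 1)) ∧
    x = r * Complex.exp (θ * Complex.I)}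

/-- Contours `Γ_1, …, Γ_d` (here indexed from `0`): `Γ_k` is a rectifiable curve, parametrized by a
Lipschitz map of `ℝ`, which comes from infinity in the sector `S_{2k-2}`, with asymptotic direction
`cIn k`, and returns to infinity in the sector `S_{2k}`, with asymptotic direction `cOut k`. -/
structure IsContourSystem (d : ℕ) (u : ℕ → ℂ) (Γ : Fin d → ℝ → ℂ) (cIn cOut : Fin d → ℂ) :
    Prop where
  lipschitz : ∀ k, ∃ C, LipschitzWith C (Γ k)
  cIn_mem : ∀ k : Fin d, cIn k ∈ sector d u (2 * k)
  cOut_mem : ∀ k : Fin d, cOut k ∈ sector d u (2 * k + 2)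
  tendsto_in : ∀ k, Tendsto (fun s : ℝ => Γ k s / ((|s| : ℝ) : ℂ)) atBot (𝓝 (cIn k))
  tendsto_out : ∀ k, Tendsto (fun s : ℝ => Γ k s / ((|s| : ℝ) : ℂ)) atTop (𝓝 (cOut k))

/-- `∫_{ϰΓ} f(x) dx = ∑_k ϰ_k ∫_{Γ_k} f(x) dx`. -/
def contourIntegral {d : ℕ} (ϰ : Fin d → ℂ) (Γ : Fin d → ℝ → ℂ) (f : ℂ → ℂ) : ℂ :=
  ∑ k, ϰ k * ∫ s : ℝ, f (Γ k s) * deriv (Γ k) s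

/-- The moment functional `L(q) = ∫_{ϰΓ} e^{-V(x)} q(x) dx`. -/
def momentFunctional {d : ℕ} (u : ℕ → ℂ) (ϰ : Fin d → ℂ) (Γ : Fin d → ℝ → ℂ) (q : ℂ[X]) : ℂ :=
  contourIntegral ϰ Γ (fun x => Complex.exp (-potential d u x) * q.eval x)

/-- `p_0, p_1, …` are the monic orthogonal polynomials of the moment functional and `h_0, h_1, …`
their (nonzero) normalization constants. -/
structure IsMonicOrthogonal {d : ℕ} (u : ℕ → ℂ) (ϰ : Fin d → ℂ) (Γ : Fin d → ℝ → ℂ)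
    (p : ℕ → ℂ[X]) (h : ℕ → ℂ) : Prop where
  monic : ∀ j, (p j).Monic
  natDegree_eq : ∀ j, (p j).natDegree = j
  h_ne_zero : ∀ j, h j ≠ 0
  orthogonal : ∀ i j, momentFunctional u ϰ Γ (p i * p j) = if i = j then h i else 0

/-- The integrand `Δ(x)² e^{-∑ V(x_j)} dx_1 ⋯ dx_n` pulled back to the parameters
`s_1, …, s_n`, with `x_j` running over the contour `Γ_{σ j}`. -/
def partitionIntegrand {d : ℕ} (n : ℕ) (v : ℕ → ℂ) (Γ : Fin d → ℝ → ℂ) (σ : Fin n → Fin d)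
    (s : Fin n → ℝ) : ℂ :=
  (∏ i : Fin n, ∏ j ∈ Finset.Ioi i, (Γ (σ i) (s i) - Γ (σ j) (s j))) ^ 2 *
    Complex.exp (-∑ j, potential d v (Γ (σ j) (s j))) * ∏ j, deriv (Γ (σ j)) (s j)

/-- The partition function
`Z_n = ∫_{ϰΓ} dx_1 ⋯ ∫_{ϰΓ} dx_n Δ(x)² e^{-∑ V(x_j)}` for the potential with coefficients `v`. -/
def partitionFunction {d : ℕ} (n : ℕ) (v : ℕ → ℂ) (ϰ : Fin d → ℂ) (Γ : Fin d → ℝ → ℂ) : ℂ :=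
  ∑ σ : Fin n → Fin d, (∏ j, ϰ (σ j)) * ∫ s : Fin n → ℝ, partitionIntegrand n v Γ σ s

/-! ### Grassmannian and tau function -/

/-- The coefficient of `z^k` in the Taylor series of `f` at the origin. -/
def taylorCoeff (f : ℂ → ℂ) (k : ℕ) : ℂ := iteratedDeriv k f 0 / (k.factorial : ℂ)

/-- The part `f_{≥ n}` of the Taylor series of an entire function `f`. -/
def tailPart (n : ℕ) (f : ℂ → ℂ) (z : ℂ) : ℂ :=
  f z - ∑ j ∈ Finset.range n, taylorCoeff f j * z ^ j

/-- `H_+ = span {z^j}_{j ≥ n}` (before completion). -/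
def polyPlus (n : ℕ) : Submodule ℂ ℂ[X] where
  carrier := {f | ∀ j < n, f.coeff j = 0}
  add_mem' hf hg j hj := by simp [hf j hj, hg j hj]
  zero_mem' := by simp
  smul_mem' c f hf j hj := by simp [hf j hj]

/-- The projection `span {z^j}_{j ≥ 0} → H_+` along `H_n = span {z^j}_{j < n}`. -/
def projPlus (n : ℕ) : ℂ[X] →ₗ[ℂ] polyPlus n where
  toFun f := ⟨f - ∑ j ∈ Finset.range n, monomial j (f.coeff j), by
    intro j hj
    simp [Polynomial.coeff_monomial, hj]⟩
  map_add' f g := by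
    ext1
    simp only [Polynomial.coeff_add, map_add, Finset.sum_add_distrib, Submodule.coe_add]
    ring
  map_smul' c f := by
    ext1
    simp [smul_sub, Finset.smul_sum, Polynomial.smul_monomial]

/-- The projection `W → H_+`. -/
def projOn (n : ℕ) (W : Submodule ℂ ℂ[X]) : W →ₗ[ℂ] polyPlus n := projPlus n ∘ₗ W.subtype

/-- `W` is commensurable with `H_+`: the projection `W → H_+` is Fredholm.  (The projection of `W`
to the `n`-dimensional complement `H_n` is automatically of finite rank.) -/
def InGrassmannian (n : ℕ) (W : Submodule ℂ ℂ[X]) : Prop :=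
  Module.Finite ℂ (LinearMap.ker (projOn n W)) ∧
    Module.Finite ℂ (polyPlus n ⧸ LinearMap.range (projOn n W))

/-- The subspace `w_0 = span {p_j}_{j ≥ n}`. -/
def initialSubspace (n : ℕ) (p : ℕ → ℂ[X]) : Submodule ℂ ℂ[X] :=
  Submodule.span ℂ (p '' {j | n ≤ j})

/-- An admissible frame of `W`: a basis `w_0, w_1, …` whose projections to `H_+` are related
to the standard basis `z^n, z^{n+1}, …` by an upper triangular matrix with unit diagonal. -/
structure IsAdmissibleFrame (n : ℕ) (W : Submodule ℂ ℂ[X]) (w : ℕ → ℂ[X]) : Prop where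
  linearIndependent : LinearIndependent ℂ w
  span_eq : Submodule.span ℂ (Set.range w) = W
  monic : ∀ j, (w j).Monic
  natDegree_eq : ∀ j, (w j).natDegree = n + j

/-- The multiplication action of the group element `γ(t) = exp (∑_J t_J z^J / J)`. -/
def flow (d : ℕ) (t : ℕ → ℂ) (f : ℂ → ℂ) (z : ℂ) : ℂ := Complex.exp (potential d t z) * f z

/-- The infinite determinant of `M`: the limit of the determinants of its `N × N` truncations. -/
def HasInfiniteDet (M : Matrix ℕ ℕ ℂ) (δ : ℂ) : Prop :=
  Tendsto (fun N : ℕ => (M.submatrix (fun i : Fin N => (i : ℕ)) (fun j : Fin N => (j : ℕ))).det)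
    atTop (𝓝 δ)

/-- The matrix of the projection to `H_+` of the frame `γ(t) w_0, γ(t) w_1, …`, in the
standard basis `z^n, z^{n+1}, …`: the `+`-block of the homogeneous coordinates of `γ(t) W`. -/
def flowedPlusBlock (d n : ℕ) (t : ℕ → ℂ) (w : ℕ → ℂ[X]) : Matrix ℕ ℕ ℂ :=
  Matrix.of fun i j => taylorCoeff (flow d t (fun z => (w j).eval z)) (n + i)

/-- `τ` is the value at `t` of the KP tau function of `W`, the Plücker coordinate of `γ(t) W`
given by the determinant of the projection to `H_+`.  It is computed in an admissible frame of
`W`; it is part of the assertion that there are such frames and that all give the same value. -/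
def IsKPTau (d n : ℕ) (W : Submodule ℂ ℂ[X]) (t : ℕ → ℂ) (τ : ℂ) : Prop :=
  (∃ w, IsAdmissibleFrame n W w) ∧
    ∀ w, IsAdmissibleFrame n W w → HasInfiniteDet (flowedPlusBlock d n t w) τ

/-! ### The integral operator -/

/-- The completion of `H_+` on which the integral operator acts: entire functions `f` with a zero
of order at least `n` at the origin for which all integrals `∫_{Γ_k} f(x) x^m e^{-V(x)} dx`
converge absolutely, `V` being the potential with coefficients `v`. -/
def hPlus {d : ℕ} (n : ℕ) (v : ℕ → ℂ) (Γ : Fin d → ℝ → ℂ) : Submodule ℂ (ℂ → ℂ) where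
  carrier := {f | Differentiable ℂ f ∧ (∀ j < n, taylorCoeff f j = 0) ∧
    ∀ (k : Fin d) (m : ℕ), Integrable (fun s : ℝ =>
      f (Γ k s) * (Γ k s ^ m * Complex.exp (-potential d v (Γ k s)) * deriv (Γ k) s))}
  add_mem' := by
    rintro f g ⟨hf, hf0, hfi⟩ ⟨hg, hg0, hgi⟩
    refine ⟨hf.add hg, fun j hj => ?_, fun k m => ?_⟩
    · have h1 : iteratedDeriv j (f + g) 0 = iteratedDeriv j f 0 + iteratedDeriv j g 0 :=
        iteratedDeriv_add hf.contDiff.contDiffAt hg.contDiff.contDiffAt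
      have h2 := hf0 j hj
      have h3 := hg0 j hj
      unfold taylorCoeff at *
      rw [h1, add_div, h2, h3, add_zero]
    · refine ((hfi k m).add (hgi k m)).congr (Eventually.of_forall fun s => ?_)
      simp [add_mul]
  zero_mem' := by
    refine ⟨differentiable_const 0, fun j _ => ?_, fun k m => by simp⟩
    have h1 : iteratedDeriv j (0 : ℂ → ℂ) 0 = 0 := iteratedDeriv_const_zero
    simp [taylorCoeff, h1]
  smul_mem' := by
    rintro c f ⟨hf, hf0, hfi⟩
    refine ⟨hf.const_smul c, fun j hj => ?_, fun k m => ?_⟩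
    · have h1 : iteratedDeriv j (c • f) 0 = c • iteratedDeriv j f 0 :=
        iteratedDeriv_const_smul hf.contDiff.contDiffAt c
      have h2 := hf0 j hj
      unfold taylorCoeff at *
      rw [h1, smul_eq_mul, mul_div_assoc, h2, mul_zero]
    · simpa [mul_assoc] using (hfi k m).const_mul c

/-- The kernel
`K(z,w) = ∑_{j<n} h_j⁻¹ (e^{∑ t_K z^K/K} p_j(z))_{≥ n} p_j(w) e^{-∑ t_K w^K/K}`. -/
def kernel (d n : ℕ) (p : ℕ → ℂ[X]) (h : ℕ → ℂ) (t : ℕ → ℂ) (z w : ℂ) : ℂ :=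
  ∑ j ∈ Finset.range n, 1 / h j * tailPart n (flow d t (fun x => (p j).eval x)) z *
    ((p j).eval w * Complex.exp (-potential d t w))

/-- The Fredholm determinant `det (1 - K)` of an operator `K` of finite rank: `K` vanishes on the
quotient by its range, so this is the determinant of `1 - K` on the range of `K`. -/
def fredholmDet {E : Type*} [AddCommGroup E] [Module ℂ E] (K : E →ₗ[ℂ] E) : ℂ :=
  LinearMap.det (LinearMap.id - K.rangeRestrict ∘ₗ (LinearMap.range K).subtype)

/-! ### Block matrices -/

/-- The matrix whose `j`-th column consists of the expansion coefficients of `p_j`. -/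
def polyMatrix (p : ℕ → ℂ[X]) : Matrix ℕ ℕ ℂ := Matrix.of fun k j => (p j).coeff k

/-- The matrix of multiplication by `γ(t)` in the basis `1, z, z², …`. -/
def flowMatrix (d : ℕ) (t : ℕ → ℂ) : Matrix ℕ ℕ ℂ :=
  Matrix.of fun i j => taylorCoeff (flow d t (fun z => z ^ j)) i

/-- The lower right block of an infinite matrix (rows and columns with index at least `n`). -/
def plusBlock (n : ℕ) (M : Matrix ℕ ℕ ℂ) : Matrix ℕ ℕ ℂ := Matrix.of fun i j => M (n + i) (n + j)

/-- The inverse of an infinite (upper or lower) triangular matrix with nonzero diagonal, whose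
finite truncations are the inverses of the truncations of the matrix. -/
def triInv (M : Matrix ℕ ℕ ℂ) : Matrix ℕ ℕ ℂ := Matrix.of fun i j =>
  (M.submatrix (fun a : Fin (max i j + 1) => (a : ℕ)) (fun b : Fin (max i j + 1) => (b : ℕ)))⁻¹
    ⟨i, by omega⟩ ⟨j, by omega⟩

/-- `W_{n+} W_+⁻¹`, where `W_{n+}` and `W_+` are the upper and lower right blocks of the upper
triangular matrix `W` of the `p_j`; the sum has only the terms allowed by triangularity. -/
def graphMatrix (n : ℕ) (p : ℕ → ℂ[X]) (a l : ℕ) : ℂ :=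
  ∑ m ∈ Finset.range (l + 1), polyMatrix p a (n + m) * triInv (plusBlock n (polyMatrix p)) m l

end KPTau

end

/-!
Orthogonality makes `w_0` the kernel of the projection `f ↦ ∑_{j<n} L(f p_j) p_j / h_j` onto the
polynomials of degree less than `n`, so that `w_0` is the graph over `H_+` of minus this projection;
in coordinates the graph is the matrix `W_{n+} W_+⁻¹`.  Expanding the squared Vandermonde
determinant gives `Z_n(t) = n! det [L_t(x^{i+j})]`, where `L_t` is the moment functional of
`V_{u+t}`, and `Z_n(0) = n! ∏_{j<n} h_j`.

The operator `K̂` is `f ↦ ∑_j ℓ_j(f) φ_j` with `ℓ_j(f) = ∫ e^{-V_{u+t}} p_j f` and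
`φ_j = h_j⁻¹ (e^{ξ_t} p_j)_{≥ n}`, so `det (1 - K̂)` is the determinant of `δ_ij - ℓ_i(φ_j)`.  This
entry is `L_t(p_i r_j) / h_j`, where `r_j` is the part of degree less than `n` of `e^{ξ_t} p_j`.
Since the `p_i` and the `r_j` arise from the monomials by unitriangular matrices, the determinant is
the ratio of the two Hankel determinants.

For the tau function, `det (1 + XY) = det (1 + YX)` reduces the truncated `N × N` determinants to
`n × n` ones, whose entries are partial sums of series `∑_l c_l(-t) L(x^l q)`, the `c_l` being the
Taylor coefficients of `e^{ξ}`.  The condition on `t_{d+1}` lets one integrate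
`∑_l c_l(-t) x^l q = e^{-ξ_t} q` term by term: the `|c_l(-t)|` are dominated by the Taylor
coefficients of `exp (∑_J |t_J| z^J / J)`, whose growth along the contours is beaten by the decay of
`e^{-V_u}`.  So the limit again involves only `L_t`.
-/

noncomputable section

namespace KPTau

open Finset.HasAntidiagonal (antidiagonal)

section TaylorCoefficients

lemma taylorCoeff_zero (f : ℂ → ℂ) : taylorCoeff f 0 = f 0 := by simp [taylorCoeff]

lemma taylorCoeff_succ (f : ℂ → ℂ) (k : ℕ) :
    (k + 1) * taylorCoeff f (k + 1) = taylorCoeff (deriv f) k := by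
  have hk : (k : ℂ) + 1 ≠ 0 := Nat.cast_add_one_ne_zero k
  rw [taylorCoeff, taylorCoeff, iteratedDeriv_succ', Nat.factorial_succ]
  push_cast
  field_simp

lemma taylorCoeff_const_mul (c : ℂ) (f : ℂ → ℂ) (k : ℕ) :
    taylorCoeff (fun z => c * f z) k = c * taylorCoeff f k := by
  rw [taylorCoeff, iteratedDeriv_const_mul_field, mul_div_assoc, taylorCoeff]

lemma taylorCoeff_sum {ι : Type*} {s : Finset ι} {f : ι → ℂ → ℂ}
    (hf : ∀ i ∈ s, AnalyticAt ℂ (f i) 0) (k : ℕ) :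
    taylorCoeff (fun z => ∑ i ∈ s, f i z) k = ∑ i ∈ s, taylorCoeff (f i) k := by
  rw [taylorCoeff, iteratedDeriv_fun_sum fun i hi => (hf i hi).contDiffAt, Finset.sum_div]
  rfl

lemma taylorCoeff_sub {f g : ℂ → ℂ} (hf : AnalyticAt ℂ f 0) (hg : AnalyticAt ℂ g 0) (k : ℕ) :
    taylorCoeff (fun z => f z - g z) k = taylorCoeff f k - taylorCoeff g k := by
  rw [taylorCoeff, iteratedDeriv_fun_sub hf.contDiffAt hg.contDiffAt, sub_div]
  rfl

lemma taylorCoeff_mul {f g : ℂ → ℂ} (hf : AnalyticAt ℂ f 0) (hg : AnalyticAt ℂ g 0) (k : ℕ) :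
    taylorCoeff (fun z => f z * g z) k =
      ∑ ij ∈ antidiagonal k, taylorCoeff f ij.1 * taylorCoeff g ij.2 := by
  rw [taylorCoeff, iteratedDeriv_fun_mul hf.contDiffAt hg.contDiffAt, Finset.sum_div,
    Finset.Nat.sum_antidiagonal_eq_sum_range_succ_mk]
  refine Finset.sum_congr rfl fun i hi => ?_
  rw [taylorCoeff, taylorCoeff, Nat.cast_choose _ (Finset.mem_range_succ_iff.mp hi)]
  field_simp [Nat.factorial_ne_zero]

lemma taylorCoeff_pow (m k : ℕ) : taylorCoeff (fun z => z ^ m) k = if k = m then 1 else 0 := by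
  rw [taylorCoeff, iteratedDeriv_fun_pow_zero]
  split_ifs with hkm
  · rw [hkm, div_self (Nat.cast_ne_zero.mpr m.factorial_ne_zero)]
  · simp

lemma taylorCoeff_eval (q : ℂ[X]) (k : ℕ) : taylorCoeff (fun z => q.eval z) k = q.coeff k := by
  simp_rw [Polynomial.eval_eq_sum_range]
  rw [taylorCoeff_sum fun i _ => by fun_prop]
  simp only [taylorCoeff_const_mul, taylorCoeff_pow, mul_ite, mul_one, mul_zero,
    Finset.sum_ite_eq, Finset.mem_range]
  split_ifs with hk
  · rfl
  · exact (Polynomial.coeff_eq_zero_of_natDegree_lt (by omega)).symm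

lemma hasSum_taylorCoeff {f : ℂ → ℂ} (hf : Differentiable ℂ f) (z : ℂ) :
    HasSum (fun k => taylorCoeff f k * z ^ k) (f z) := by
  refine (Complex.hasSum_taylorSeries_of_entire hf 0 z).congr_fun fun k => ?_
  rw [taylorCoeff, sub_zero, smul_eq_mul, smul_eq_mul]
  ring

end TaylorCoefficients

section ExponentialOfPolynomial

lemma analyticAt_cexp_eval (q : ℂ[X]) (z : ℂ) :
    AnalyticAt ℂ (fun z => Complex.exp (q.eval z)) z :=
  (q.differentiable.cexp).analyticAt z

lemma succ_mul_taylorCoeff_cexp_eval (q : ℂ[X]) (k : ℕ) :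
    (k + 1) * taylorCoeff (fun z => Complex.exp (q.eval z)) (k + 1) =
      ∑ ij ∈ antidiagonal k, q.derivative.coeff ij.1 *
        taylorCoeff (fun z => Complex.exp (q.eval z)) ij.2 := by
  have deriv_exp : deriv (fun z => Complex.exp (q.eval z)) =
      fun z => q.derivative.eval z * Complex.exp (q.eval z) := by
    funext z
    rw [((q.hasDerivAt z).cexp).deriv, mul_comm]
  rw [taylorCoeff_succ, deriv_exp,
    taylorCoeff_mul (q.derivative.differentiable.analyticAt 0) (analyticAt_cexp_eval q 0)]
  simp only [taylorCoeff_eval]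

open scoped ComplexOrder

lemma norm_natCast_add_one (k : ℕ) : ‖(k : ℂ) + 1‖ = k + 1 := by
  exact_mod_cast Complex.norm_natCast (k + 1)

lemma norm_coeff_derivative_le {q Q : ℂ[X]} (hqQ : ∀ i, (‖q.coeff i‖ : ℂ) ≤ Q.coeff i) (i : ℕ) :
    (‖q.derivative.coeff i‖ : ℂ) ≤ Q.derivative.coeff i := by
  have hi : (0 : ℂ) ≤ i + 1 := by exact_mod_cast (i + 1).zero_le
  rw [Polynomial.coeff_derivative, Polynomial.coeff_derivative, norm_mul, norm_natCast_add_one]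
  push_cast
  exact mul_le_mul_of_nonneg_right (hqQ _) hi

lemma norm_cexp_le_of_norm_le {a b : ℂ} (hab : (‖a‖ : ℂ) ≤ b) :
    (‖Complex.exp a‖ : ℂ) ≤ Complex.exp b := by
  obtain ⟨r, rfl⟩ : ∃ r : ℝ, b = r := ⟨_, Complex.eq_re_of_ofReal_le hab⟩
  rw [← Complex.ofReal_exp, Complex.real_le_real, Complex.norm_exp]
  exact Real.exp_le_exp.mpr ((Complex.re_le_norm a).trans (Complex.real_le_real.mp hab))

lemma norm_taylorCoeff_cexp_eval_le {q Q : ℂ[X]} (hqQ : ∀ i, (‖q.coeff i‖ : ℂ) ≤ Q.coeff i)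
    (k : ℕ) :
    (‖taylorCoeff (fun z => Complex.exp (q.eval z)) k‖ : ℂ) ≤
      taylorCoeff (fun z => Complex.exp (Q.eval z)) k := by
  induction k using Nat.strong_induction_on with
  | _ k ih =>
    rcases k with _ | k
    · simp only [taylorCoeff_zero, ← Polynomial.coeff_zero_eq_eval_zero]
      exact norm_cexp_le_of_norm_le (hqQ 0)
    have hk : (0 : ℂ) < k + 1 := by exact_mod_cast k.succ_pos
    have norm_nonneg' (w : ℂ) : (0 : ℂ) ≤ ‖w‖ := by exact_mod_cast norm_nonneg w
    refine le_of_mul_le_mul_left ?_ hk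
    calc ((k : ℂ) + 1) * ‖taylorCoeff (fun z => Complex.exp (q.eval z)) (k + 1)‖
        = (‖∑ ij ∈ antidiagonal k, q.derivative.coeff ij.1 *
            taylorCoeff (fun z => Complex.exp (q.eval z)) ij.2‖ : ℝ) := by
          rw [← succ_mul_taylorCoeff_cexp_eval, norm_mul, norm_natCast_add_one]
          push_cast
          rfl
      _ ≤ ∑ ij ∈ antidiagonal k, (‖q.derivative.coeff ij.1‖ : ℂ) *
            ‖taylorCoeff (fun z => Complex.exp (q.eval z)) ij.2‖ := by
          exact_mod_cast (norm_sum_le _ _).trans_eq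
            (Finset.sum_congr rfl fun ij _ => norm_mul _ _)
      _ ≤ ∑ ij ∈ antidiagonal k, Q.derivative.coeff ij.1 *
            taylorCoeff (fun z => Complex.exp (Q.eval z)) ij.2 := by
          refine Finset.sum_le_sum fun ij hij => ?_
          have hj := Finset.HasAntidiagonal.mem_antidiagonal.mp hij
          have hderiv := norm_coeff_derivative_le hqQ ij.1
          exact mul_le_mul hderiv (ih _ (by omega)) (norm_nonneg' _)
            ((norm_nonneg' _).trans hderiv)
      _ = (k + 1) * taylorCoeff (fun z => Complex.exp (Q.eval z)) (k + 1) :=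
          (succ_mul_taylorCoeff_cexp_eval Q k).symm

end ExponentialOfPolynomial

section Potential

/-- The potential `∑_{K=1}^{d+1} a_K x^K / K` as a polynomial. -/
def potentialPoly (d : ℕ) (a : ℕ → ℂ) : ℂ[X] :=
  ∑ K ∈ Finset.Icc 1 (d + 1), monomial K (a K / K)

variable (d : ℕ) (a b : ℕ → ℂ)

lemma eval_potentialPoly (x : ℂ) : (potentialPoly d a).eval x = potential d a x := by
  simp only [potentialPoly, potential, Polynomial.eval_finsetSum, Polynomial.eval_monomial,
    div_mul_eq_mul_div]

lemma coeff_potentialPoly (i : ℕ) :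
    (potentialPoly d a).coeff i = if i ∈ Finset.Icc 1 (d + 1) then a i / i else 0 := by
  simp [potentialPoly, Polynomial.finsetSum_coeff, Polynomial.coeff_monomial]

lemma potential_add (x : ℂ) : potential d (a + b) x = potential d a x + potential d b x := by
  simp only [potential, Pi.add_apply, add_mul, add_div, Finset.sum_add_distrib]

lemma potential_neg (x : ℂ) : potential d (-a) x = -potential d a x := by
  simp only [potential, Pi.neg_apply, neg_mul, neg_div, Finset.sum_neg_distrib]

lemma potential_zero : potential d a 0 = 0 :=
  Finset.sum_eq_zero fun K hK => by
    simp [(Nat.one_le_iff_ne_zero.mp (Finset.mem_Icc.mp hK).1)]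

lemma differentiable_potential : Differentiable ℂ (potential d a) := by
  simpa only [eval_potentialPoly] using (potentialPoly d a).differentiable

end Potential

section ExpCoeff

open scoped ComplexOrder

/-- The coefficient of `z^k` in `exp (∑_K a_K z^K / K)`. -/
def expCoeff (d : ℕ) (a : ℕ → ℂ) (k : ℕ) : ℂ :=
  taylorCoeff (fun z => Complex.exp (potential d a z)) k

variable (d : ℕ) (a : ℕ → ℂ)

lemma hasSum_expCoeff (z : ℂ) :
    HasSum (fun k => expCoeff d a k * z ^ k) (Complex.exp (potential d a z)) :=
  hasSum_taylorCoeff (differentiable_potential d a).cexp z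

lemma expCoeff_zero : expCoeff d a 0 = 1 := by
  rw [expCoeff, taylorCoeff_zero, potential_zero, Complex.exp_zero]

lemma norm_expCoeff_le (k : ℕ) : (‖expCoeff d a k‖ : ℂ) ≤ expCoeff d (fun J => ‖a J‖) k := by
  simp only [expCoeff, ← eval_potentialPoly]
  refine norm_taylorCoeff_cexp_eval_le (fun i => ?_) k
  rw [coeff_potentialPoly, coeff_potentialPoly]
  split_ifs <;> simp

lemma sum_norm_expCoeff_mul_pow_le {r : ℝ} (hr : 0 ≤ r) (N : ℕ) :
    ∑ k ∈ Finset.range N, ‖expCoeff d a k‖ * r ^ k ≤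
      Real.exp (∑ J ∈ Finset.Icc 1 (d + 1), ‖a J‖ * r ^ J / J) := by
  have hr' (k : ℕ) : (0 : ℂ) ≤ (r : ℂ) ^ k := by exact_mod_cast pow_nonneg hr k
  have hle (k : ℕ) := norm_expCoeff_le d a k
  have hnonneg (k : ℕ) : 0 ≤ expCoeff d (fun J => ‖a J‖) k :=
    le_trans (by exact_mod_cast norm_nonneg _) (hle k)
  have hsum := sum_le_hasSum (Finset.range N) (fun k _ => mul_nonneg (hnonneg k) (hr' k))
    (hasSum_expCoeff d (fun J => ‖a J‖) r)
  have := (Finset.sum_le_sum fun k _ => mul_le_mul_of_nonneg_right (hle k) (hr' k)).trans hsum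
  rw [potential] at this
  exact_mod_cast this

end ExpCoeff

section FlowMatrix

variable (d : ℕ) (t : ℕ → ℂ)

lemma differentiable_flow {f : ℂ → ℂ} (hf : Differentiable ℂ f) : Differentiable ℂ (flow d t f) :=
  (differentiable_potential d t).cexp.mul hf

lemma taylorCoeff_flow_eq_sum_antidiagonal {f : ℂ → ℂ} (hf : AnalyticAt ℂ f 0) (i : ℕ) :
    taylorCoeff (flow d t f) i =
      ∑ kl ∈ antidiagonal i, expCoeff d t kl.1 * taylorCoeff f kl.2 :=
  taylorCoeff_mul ((differentiable_potential d t).cexp.analyticAt 0) hf i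

lemma flowMatrix_apply (i j : ℕ) :
    flowMatrix d t i j = if j ≤ i then expCoeff d t (i - j) else 0 := by
  rw [flowMatrix, Matrix.of_apply, taylorCoeff_flow_eq_sum_antidiagonal d t (by fun_prop),
    Finset.Nat.sum_antidiagonal_eq_sum_range_succ_mk]
  simp only [taylorCoeff_pow, mul_ite, mul_one, mul_zero]
  split_ifs with hji
  · rw [Finset.sum_eq_single_of_mem (i - j) (Finset.mem_range.mpr (by omega))
      fun k hk hne => if_neg (by have := Finset.mem_range.mp hk; omega), if_pos (by omega)]
  · exact Finset.sum_eq_zero fun k _ => if_neg (by omega)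

lemma flowMatrix_self (i : ℕ) : flowMatrix d t i i = 1 := by
  simp [flowMatrix_apply, expCoeff_zero]

lemma flowMatrix_of_lt {i j : ℕ} (hij : i < j) : flowMatrix d t i j = 0 := by
  simp [flowMatrix_apply, hij]

lemma flowMatrix_add_add (m i j : ℕ) : flowMatrix d t (m + i) (m + j) = flowMatrix d t i j := by
  simp [flowMatrix_apply, Nat.add_sub_add_left]

lemma taylorCoeff_flow {f : ℂ → ℂ} (hf : AnalyticAt ℂ f 0) {i N : ℕ} (hi : i < N) :
    taylorCoeff (flow d t f) i = ∑ j ∈ Finset.range N, flowMatrix d t i j * taylorCoeff f j := by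
  rw [taylorCoeff_flow_eq_sum_antidiagonal d t hf,
    Finset.Nat.sum_antidiagonal_eq_sum_range_succ_mk, ← Finset.sum_range_reflect]
  refine Finset.sum_subset_zero_on_sdiff (Finset.range_subset_range.mpr hi) (fun j hj => ?_)
    fun j hj => ?_
  · rw [flowMatrix_of_lt d t (by simpa using (Finset.mem_sdiff.mp hj).2), zero_mul]
  · have hji := Finset.mem_range_succ_iff.mp hj
    rw [flowMatrix_apply, if_pos hji, Nat.succ_sub_one, Nat.sub_sub_self hji]

lemma taylorCoeff_flow_eval {q : ℂ[X]} {N : ℕ} (hq : q.degree < N) (i : ℕ) :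
    taylorCoeff (flow d t fun z => q.eval z) i =
      ∑ j ∈ Finset.range N, flowMatrix d t i j * q.coeff j := by
  rw [taylorCoeff_flow d t (q.differentiable.analyticAt 0) (N := max N (i + 1)) (by omega)]
  simp only [taylorCoeff_eval]
  refine (Finset.sum_subset (Finset.range_mono (le_max_left _ _)) fun j _ hj => ?_).symm
  rw [Polynomial.coeff_eq_zero_of_degree_lt (hq.trans_le ?_), mul_zero]
  exact_mod_cast not_lt.mp (Finset.mem_range.not.mp hj)

lemma sum_flowMatrix_neg_mul_flowMatrix {i N : ℕ} (hi : i < N) (j : ℕ) :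
    ∑ l ∈ Finset.range N, flowMatrix d (-t) i l * flowMatrix d t l j = if i = j then 1 else 0 := by
  have flow_neg_flow : flow d (-t) (flow d t fun z => z ^ j) = fun z => z ^ j := by
    funext z
    rw [flow, flow, potential_neg, ← mul_assoc, ← Complex.exp_add, neg_add_cancel,
      Complex.exp_zero, one_mul]
  rw [← taylorCoeff_pow, ← flow_neg_flow,
    taylorCoeff_flow d (-t) ((differentiable_flow d t (by fun_prop)).analyticAt 0) hi]
  rfl

end FlowMatrix

section Asymptotics

lemma tendsto_inv_pow_smul_sum_mul_pow {ι 𝕜 : Type*} [NormedField 𝕜] [NormedAlgebra ℝ 𝕜] (d : ℕ)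
    (a : ℕ → 𝕜) {l : Filter ι} {r : ι → ℝ} (hr : Tendsto r l atTop) {γ : ι → 𝕜} {c : 𝕜}
    (hγ : Tendsto (fun s => (r s)⁻¹ • γ s) l (𝓝 c)) :
    Tendsto (fun s => (r s ^ (d + 1))⁻¹ • ∑ K ∈ Finset.Icc 1 (d + 1), a K * γ s ^ K / K) l
      (𝓝 (a (d + 1) * c ^ (d + 1) / ((d + 1 : ℕ) : 𝕜))) := by
  have hterm (K : ℕ) (hK : K ∈ Finset.Icc 1 (d + 1)) :
      Tendsto (fun s => (r s ^ (d + 1))⁻¹ • (a K * γ s ^ K / K)) l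
        (𝓝 ((0 : ℝ) ^ (d + 1 - K) • (a K * c ^ K / K))) := by
    refine (((tendsto_inv_atTop_zero.comp hr).pow (d + 1 - K)).smul
      (((hγ.pow K).const_mul (a K)).div_const (K : 𝕜))).congr fun s => ?_
    rw [Function.comp_apply, _root_.smul_pow, mul_smul_comm, smul_div_assoc, smul_smul, ← pow_add,
      Nat.sub_add_cancel (Finset.mem_Icc.mp hK).2, inv_pow]
  convert tendsto_finsetSum _ hterm using 2
  · rw [Finset.smul_sum]
  · rw [Finset.sum_eq_single_of_mem (d + 1) (by simp) fun K hK hne => ?_]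
    · simp
    · rw [zero_pow (by have := Finset.mem_Icc.mp hK; omega), zero_smul]

lemma isBigO_exp_neg_mul_of_tendsto_div_pow {ι : Type*} {l : Filter ι} {r F : ι → ℝ} {N : ℕ}
    {α : ℝ} (hr : Tendsto r l atTop) (hα : α < 0)
    (hF : Tendsto (fun s => F s / r s ^ (N + 1)) l (𝓝 α)) :
    ∃ b > 0, (fun s => Real.exp (F s)) =O[l] fun s => Real.exp (-(b * r s)) := by
  refine ⟨-α / 2, by linarith, Asymptotics.IsBigO.of_norm_eventuallyLE ?_⟩
  filter_upwards [hr.eventually_ge_atTop 1, hF.eventually_lt_const (show α < α / 2 by linarith)]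
    with s hs hFs
  rw [div_lt_iff₀ (by positivity)] at hFs
  have hpow : r s ≤ r s ^ (N + 1) := le_self_pow₀ hs N.succ_ne_zero
  rw [Real.norm_of_nonneg (Real.exp_pos _).le, Real.exp_le_exp]
  nlinarith

lemma isBigO_pow_mul_exp_neg_mul (m : ℕ) {b : ℝ} (hb : 0 < b) :
    (fun x : ℝ => x ^ m * Real.exp (-(b * x))) =O[atTop] fun x => (1 + x ^ 2)⁻¹ := by
  have hpoly : (fun x : ℝ => x ^ m + x ^ (m + 2)) =O[atTop] fun x => Real.exp (b * x) :=
    ((isLittleO_pow_exp_pos_mul_atTop m hb).add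
      (isLittleO_pow_exp_pos_mul_atTop (m + 2) hb)).isBigO
  refine (hpoly.mul (Asymptotics.isBigO_refl
    (fun x : ℝ => Real.exp (-(b * x)) * (1 + x ^ 2)⁻¹) atTop)).congr (fun x => ?_) fun x => ?_
  · have hx : (1 : ℝ) + x ^ 2 ≠ 0 := by positivity
    field_simp
    ring
  · rw [← mul_assoc, ← Real.exp_add, add_neg_cancel, Real.exp_zero, one_mul]

lemma hasSum_integral_of_sum_norm_le {α E : Type*} [MeasurableSpace α] {μ : Measure α}
    [NormedAddCommGroup E] [NormedSpace ℝ E] {F : ℕ → α → E} {f : α → E} {g : α → ℝ}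
    (hF : ∀ l, Integrable (F l) μ) (hg : Integrable g μ)
    (hFg : ∀ N x, ∑ l ∈ Finset.range N, ‖F l x‖ ≤ g x) (hf : ∀ x, HasSum (fun l => F l x) (f x)) :
    HasSum (fun l => ∫ x, F l x ∂μ) (∫ x, f x ∂μ) := by
  have hsummable : Summable fun l => ∫ x, ‖F l x‖ ∂μ := by
    refine summable_of_sum_range_le (c := ∫ x, g x ∂μ)
      (fun l => integral_nonneg fun x => norm_nonneg _) fun N => ?_
    rw [← integral_finsetSum _ fun l _ => (hF l).norm]
    exact integral_mono (integrable_finsetSum _ fun l _ => (hF l).norm) hg (hFg N)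
  simpa only [(hf _).tsum_eq] using hasSum_integral_of_summable_integral_norm hF hsummable

end Asymptotics

section Curve

/-- A Lipschitz curve in the plane which comes from infinity in the direction `cIn` and returns to
infinity in the direction `cOut`, at asymptotically constant speed. -/
structure IsAsymptoticCurve (γ : ℝ → ℂ) (cIn cOut : ℂ) : Prop where
  lipschitz : ∃ C, LipschitzWith C γ
  tendsto_in : Tendsto (fun s : ℝ => γ s / ((|s| : ℝ) : ℂ)) atBot (𝓝 cIn)
  tendsto_out : Tendsto (fun s : ℝ => γ s / ((|s| : ℝ) : ℂ)) atTop (𝓝 cOut)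

lemma IsAsymptoticCurve.continuous {γ : ℝ → ℂ} {cIn cOut : ℂ} (hγ : IsAsymptoticCurve γ cIn cOut) :
    Continuous γ := hγ.lipschitz.choose_spec.continuous

/-- The exponent of the majorants `exp (-Re V(x) + ∑_J τ_J |x|^J / J)` by which the integrands on
the contours are dominated, `V` being the potential with coefficients `v`. -/
def growth (d : ℕ) (v : ℕ → ℂ) (τ : ℕ → ℝ) (x : ℂ) : ℝ :=
  -(potential d v x).re + ∑ J ∈ Finset.Icc 1 (d + 1), τ J * ‖x‖ ^ J / J

variable (d : ℕ) (v : ℕ → ℂ) (τ : ℕ → ℝ)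

lemma continuous_growth : Continuous (growth d v τ) := by
  have := (differentiable_potential d v).continuous
  unfold growth
  fun_prop

lemma growth_zero (x : ℂ) : growth d v 0 x = -(potential d v x).re := by simp [growth]

lemma sum_norm_expCoeff_mul_pow_mul_norm_cexp_le (t : ℕ → ℂ) (x : ℂ) (N : ℕ) :
    (∑ l ∈ Finset.range N, ‖expCoeff d t l‖ * ‖x‖ ^ l) * ‖Complex.exp (-potential d v x)‖ ≤
      Real.exp (growth d v (fun J => ‖t J‖) x) := by
  rw [growth, Real.exp_add, mul_comm, Complex.norm_exp, Complex.neg_re]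
  exact mul_le_mul_of_nonneg_left (sum_norm_expCoeff_mul_pow_le d t (norm_nonneg x) N)
    (Real.exp_pos _).le

lemma tendsto_growth_div {γ : ℝ → ℂ} {c : ℂ} {l : Filter ℝ} (hl : Tendsto (fun s => |s|) l atTop)
    (hγ : Tendsto (fun s : ℝ => γ s / ((|s| : ℝ) : ℂ)) l (𝓝 c)) :
    Tendsto (fun s => growth d v τ (γ s) / |s| ^ (d + 1)) l
      (𝓝 ((τ (d + 1) * ‖c‖ ^ (d + 1) - (v (d + 1) * c ^ (d + 1)).re) / (d + 1))) := by
  replace hγ : Tendsto (fun s : ℝ => |s|⁻¹ • γ s) l (𝓝 c) := hγ.congr fun s => by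
    rw [Complex.real_smul, Complex.ofReal_inv, div_eq_inv_mul]
  have hnorm : Tendsto (fun s : ℝ => |s|⁻¹ • ‖γ s‖) l (𝓝 ‖c‖) := hγ.norm.congr fun s => by
    rw [norm_smul, norm_inv, Real.norm_eq_abs, abs_abs, smul_eq_mul]
  have hre := (Complex.continuous_re.tendsto _).comp
    (tendsto_inv_pow_smul_sum_mul_pow d v hl hγ)
  have hadd := hre.neg.add (tendsto_inv_pow_smul_sum_mul_pow d τ hl hnorm)
  rw [Complex.div_natCast_re] at hadd
  convert hadd using 2 with s
  · simp only [growth, potential, Function.comp_apply, Complex.smul_re, smul_eq_mul]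
    ring
  · push_cast
    ring

variable {γ : ℝ → ℂ} {cIn cOut : ℂ}

lemma isBigO_norm_pow_mul_exp_growth {c : ℂ} {l : Filter ℝ} (hl : Tendsto (fun s => |s|) l atTop)
    (hγ : Tendsto (fun s : ℝ => γ s / ((|s| : ℝ) : ℂ)) l (𝓝 c))
    (hc : τ (d + 1) * ‖c‖ ^ (d + 1) < (v (d + 1) * c ^ (d + 1)).re) (m : ℕ) :
    (fun s => ‖γ s‖ ^ m * Real.exp (growth d v τ (γ s))) =O[l] fun s => (1 + s ^ 2)⁻¹ := by
  have hlim : (τ (d + 1) * ‖c‖ ^ (d + 1) - (v (d + 1) * c ^ (d + 1)).re) / (d + 1) < 0 :=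
    div_neg_of_neg_of_pos (by linarith) (by positivity)
  obtain ⟨b, hb, hexp⟩ :=
    isBigO_exp_neg_mul_of_tendsto_div_pow hl hlim (tendsto_growth_div d v τ hl hγ)
  have hlin : (fun s => ‖γ s‖) =O[l] fun s => |s| := by
    refine (hγ.norm.isBigO_one ℝ).mul (Asymptotics.isBigO_refl (fun s : ℝ => |s|) l)
      |>.congr' ?_ (by simp)
    filter_upwards [hl.eventually_gt_atTop 0] with s hs
    rw [norm_div, Complex.norm_real, Real.norm_eq_abs, abs_abs, div_mul_cancel₀ _ hs.ne']
  refine ((hlin.pow m).mul hexp).trans ?_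
  simpa only [Function.comp_def, sq_abs] using (isBigO_pow_mul_exp_neg_mul m hb).comp_tendsto hl

variable {d v τ}

lemma IsAsymptoticCurve.integrable_norm_pow_mul_exp_growth (hγ : IsAsymptoticCurve γ cIn cOut)
    (hin : τ (d + 1) * ‖cIn‖ ^ (d + 1) < (v (d + 1) * cIn ^ (d + 1)).re)
    (hout : τ (d + 1) * ‖cOut‖ ^ (d + 1) < (v (d + 1) * cOut ^ (d + 1)).re) (m : ℕ) :
    Integrable fun s => ‖γ s‖ ^ m * Real.exp (growth d v τ (γ s)) := by
  have hcont : Continuous fun s => ‖γ s‖ ^ m * Real.exp (growth d v τ (γ s)) :=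
    (hγ.continuous.norm.pow m).mul ((continuous_growth d v τ).comp hγ.continuous).rexp
  exact hcont.locallyIntegrable.integrable_of_isBigO_atBot_atTop
    (isBigO_norm_pow_mul_exp_growth d v τ tendsto_abs_atBot_atTop hγ.tendsto_in hin m)
    (integrable_inv_one_add_sq.integrableAtFilter _)
    (isBigO_norm_pow_mul_exp_growth d v τ tendsto_abs_atTop_atTop hγ.tendsto_out hout m)
    (integrable_inv_one_add_sq.integrableAtFilter _)

lemma IsAsymptoticCurve.integrable_norm_eval_mul_exp_growth (hγ : IsAsymptoticCurve γ cIn cOut)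
    (hin : τ (d + 1) * ‖cIn‖ ^ (d + 1) < (v (d + 1) * cIn ^ (d + 1)).re)
    (hout : τ (d + 1) * ‖cOut‖ ^ (d + 1) < (v (d + 1) * cOut ^ (d + 1)).re) (q : ℂ[X]) :
    Integrable fun s => ‖q.eval (γ s)‖ * Real.exp (growth d v τ (γ s)) := by
  have hgrowth := (continuous_growth d v τ).comp hγ.continuous
  have hsum : Integrable fun s => ∑ m ∈ Finset.range (q.natDegree + 1),
      ‖q.coeff m‖ * (‖γ s‖ ^ m * Real.exp (growth d v τ (γ s))) :=
    integrable_finsetSum _ fun m _ =>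
      (hγ.integrable_norm_pow_mul_exp_growth hin hout m).const_mul _
  refine hsum.mono' ((q.continuous.comp hγ.continuous).norm.mul
    hgrowth.rexp).aestronglyMeasurable (.of_forall fun s => ?_)
  rw [norm_mul, norm_norm, Real.norm_of_nonneg (Real.exp_pos _).le, Polynomial.eval_eq_sum_range]
  simp only [← mul_assoc, ← Finset.sum_mul, ← norm_pow, ← norm_mul]
  exact mul_le_mul_of_nonneg_right (norm_sum_le _ _) (Real.exp_pos _).le

lemma IsAsymptoticCurve.integrable_mul_deriv (hγ : IsAsymptoticCurve γ cIn cOut) {f : ℂ → ℂ}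
    (hf : Continuous f) {g : ℝ → ℝ} (hg : Integrable g) (hfg : ∀ s, ‖f (γ s)‖ ≤ g s) :
    Integrable fun s => f (γ s) * deriv γ s := by
  obtain ⟨C, hC⟩ := hγ.lipschitz
  exact (hg.mono' (hf.comp hγ.continuous).aestronglyMeasurable (.of_forall hfg)).mul_bdd
    (c := C) (measurable_deriv γ).aestronglyMeasurable
    (.of_forall fun s => norm_deriv_le_of_lipschitz hC)

lemma IsAsymptoticCurve.integrable_cexp_neg_potential_mul_eval
    (hγ : IsAsymptoticCurve γ cIn cOut) (hin : 0 < (v (d + 1) * cIn ^ (d + 1)).re)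
    (hout : 0 < (v (d + 1) * cOut ^ (d + 1)).re) (q : ℂ[X]) :
    Integrable fun s => Complex.exp (-potential d v (γ s)) * q.eval (γ s) * deriv γ s := by
  have hcont : Continuous fun x => Complex.exp (-potential d v x) * q.eval x :=
    (differentiable_potential d v).continuous.neg.cexp.mul q.continuous
  have hmajorant : Integrable fun s => ‖q.eval (γ s)‖ * Real.exp (growth d v 0 (γ s)) :=
    hγ.integrable_norm_eval_mul_exp_growth (by simpa using hin) (by simpa using hout) q
  refine hγ.integrable_mul_deriv hcont hmajorant fun s => ?_
  rw [norm_mul, Complex.norm_exp, Complex.neg_re, growth_zero, mul_comm]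

lemma IsAsymptoticCurve.hasSum_expCoeff_mul_integral (hγ : IsAsymptoticCurve γ cIn cOut)
    {t : ℕ → ℂ} (hin : ‖t (d + 1)‖ * ‖cIn‖ ^ (d + 1) < (v (d + 1) * cIn ^ (d + 1)).re)
    (hout : ‖t (d + 1)‖ * ‖cOut‖ ^ (d + 1) < (v (d + 1) * cOut ^ (d + 1)).re) (q : ℂ[X]) :
    HasSum (fun l => expCoeff d (-t) l *
        ∫ s, Complex.exp (-potential d v (γ s)) * (X ^ l * q).eval (γ s) * deriv γ s)
      (∫ s, Complex.exp (-potential d (v + t) (γ s)) * q.eval (γ s) * deriv γ s) := by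
  obtain ⟨C, hC⟩ := hγ.lipschitz
  have integrable_term (l : ℕ) := hγ.integrable_cexp_neg_potential_mul_eval
    (lt_of_le_of_lt (by positivity) hin) (lt_of_le_of_lt (by positivity) hout) (X ^ l * q)
  have integrable_majorant : Integrable fun s =>
      ‖q.eval (γ s)‖ * Real.exp (growth d v (fun J => ‖(-t) J‖) (γ s)) * (C : ℝ) :=
    (hγ.integrable_norm_eval_mul_exp_growth (by simpa using hin) (by simpa using hout)
      q).mul_const _
  have sum_norm_le (N : ℕ) (s : ℝ) : ∑ l ∈ Finset.range N, ‖expCoeff d (-t) l *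
        (Complex.exp (-potential d v (γ s)) * (X ^ l * q).eval (γ s) * deriv γ s)‖ ≤
      ‖q.eval (γ s)‖ * Real.exp (growth d v (fun J => ‖(-t) J‖) (γ s)) * C := by
    calc _ = ‖q.eval (γ s)‖ * ((∑ l ∈ Finset.range N, ‖expCoeff d (-t) l‖ * ‖γ s‖ ^ l) *
            ‖Complex.exp (-potential d v (γ s))‖) * ‖deriv γ s‖ := by
          simp only [Finset.sum_mul, Finset.mul_sum, eval_mul, eval_pow, eval_X, norm_mul, norm_pow]
          exact Finset.sum_congr rfl fun l _ => by ring
      _ ≤ _ := by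
          gcongr
          · exact sum_norm_expCoeff_mul_pow_mul_norm_cexp_le d v (-t) (γ s) N
          · exact norm_deriv_le_of_lipschitz hC
  have hasSum_integrand (s : ℝ) : HasSum (fun l => expCoeff d (-t) l *
        (Complex.exp (-potential d v (γ s)) * (X ^ l * q).eval (γ s) * deriv γ s))
      (Complex.exp (-potential d (v + t) (γ s)) * q.eval (γ s) * deriv γ s) := by
    have hexp : Complex.exp (-potential d (v + t) (γ s)) =
        Complex.exp (potential d (-t) (γ s)) * Complex.exp (-potential d v (γ s)) := by
      rw [potential_add, potential_neg, neg_add_rev, Complex.exp_add]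
    rw [hexp, mul_assoc, mul_assoc]
    refine ((hasSum_expCoeff d (-t) (γ s)).mul_right _).congr_fun fun l => ?_
    rw [eval_mul, eval_pow, eval_X]
    ring
  have := hasSum_integral_of_sum_norm_le (fun l => (integrable_term l).const_mul _)
    integrable_majorant sum_norm_le hasSum_integrand
  simpa only [integral_const_mul] using this

end Curve

section Sector

lemma re_mul_polar_pow (z : ℂ) (r θ : ℝ) (m : ℕ) :
    (z * (r * Complex.exp (θ * Complex.I)) ^ m).re =
      ‖z‖ * r ^ m * Real.cos (Complex.arg z + m * θ) := by
  have hpolar : z * (r * Complex.exp (θ * Complex.I)) ^ m =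
      ((‖z‖ * r ^ m : ℝ) : ℂ) * Complex.exp (((Complex.arg z + m * θ : ℝ) : ℂ) * Complex.I) := by
    nth_rewrite 1 [← Complex.norm_mul_exp_arg_mul_I z]
    rw [mul_pow, ← Complex.exp_nat_mul]
    push_cast
    rw [add_mul, Complex.exp_add, mul_assoc (m : ℂ)]
    ring
  rw [hpolar, Complex.re_ofReal_mul, Complex.exp_ofReal_mul_I_re]

lemma re_mul_pow_pos_of_mem_sector {d : ℕ} {u : ℕ → ℂ} (hu : u (d + 1) ≠ 0) {k : ℕ} {c : ℂ}
    (hc : c ∈ sector d u (2 * k)) : 0 < (u (d + 1) * c ^ (d + 1)).re := by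
  obtain ⟨r, θ, hr, hlower, hupper, rfl⟩ := hc
  rw [re_mul_polar_pow]
  refine mul_pos (mul_pos (norm_pos_iff.mpr hu) (pow_pos hr _)) ?_
  rw [← Real.cos_sub_nat_mul_two_pi _ k]
  have hd : (0 : ℝ) < d + 1 := by positivity
  rw [← sub_pos] at hlower hupper
  have hlower' := mul_pos hlower hd
  have hupper' := mul_pos hupper hd
  apply Real.cos_pos_of_mem_Ioo
  constructor
  · field_simp at hlower'
    push_cast at hlower' ⊢
    linarith
  · field_simp at hupper'
    push_cast at hupper' ⊢
    linarith

variable {d : ℕ} {u : ℕ → ℂ} {Γ : Fin d → ℝ → ℂ} {cIn cOut : Fin d → ℂ}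

lemma IsContourSystem.isAsymptoticCurve (hΓ : IsContourSystem d u Γ cIn cOut) (k : Fin d) :
    IsAsymptoticCurve (Γ k) (cIn k) (cOut k) :=
  ⟨hΓ.lipschitz k, hΓ.tendsto_in k, hΓ.tendsto_out k⟩

lemma IsContourSystem.re_mul_pow_pos (hΓ : IsContourSystem d u Γ cIn cOut)
    (hu : u (d + 1) ≠ 0) (k : Fin d) :
    0 < (u (d + 1) * cIn k ^ (d + 1)).re ∧ 0 < (u (d + 1) * cOut k ^ (d + 1)).re :=
  ⟨re_mul_pow_pos_of_mem_sector hu (hΓ.cIn_mem k),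
    re_mul_pow_pos_of_mem_sector (k := k + 1) hu (hΓ.cOut_mem k)⟩

end Sector

section Contours

variable {d : ℕ} {Γ : Fin d → ℝ → ℂ}

/-- Absolute convergence of `∫_{Γ_k} f(x) dx` for all `k`. -/
def ContourIntegrable (Γ : Fin d → ℝ → ℂ) (f : ℂ → ℂ) : Prop :=
  ∀ k, Integrable fun s : ℝ => f (Γ k s) * deriv (Γ k) s

lemma ContourIntegrable.const_mul {f : ℂ → ℂ} (hf : ContourIntegrable Γ f) (c : ℂ) :
    ContourIntegrable Γ fun x => c * f x := fun k => by
  simpa only [mul_assoc] using (hf k).const_mul c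

lemma contourIntegral_add (ϰ : Fin d → ℂ) {f g : ℂ → ℂ} (hf : ContourIntegrable Γ f)
    (hg : ContourIntegrable Γ g) :
    contourIntegral ϰ Γ (fun x => f x + g x) = contourIntegral ϰ Γ f + contourIntegral ϰ Γ g := by
  simp only [contourIntegral, ← Finset.sum_add_distrib, ← mul_add, add_mul]
  exact Finset.sum_congr rfl fun k _ => by rw [integral_add (hf k) (hg k)]

lemma contourIntegral_const_mul (ϰ : Fin d → ℂ) (c : ℂ) (f : ℂ → ℂ) :
    contourIntegral ϰ Γ (fun x => c * f x) = c * contourIntegral ϰ Γ f := by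
  simp only [contourIntegral, Finset.mul_sum, mul_assoc c, integral_const_mul]
  exact Finset.sum_congr rfl fun k _ => mul_left_comm _ _ _

lemma contourIntegral_sum (ϰ : Fin d → ℂ) {ι : Type*} (s : Finset ι) {f : ι → ℂ → ℂ}
    (hf : ∀ i ∈ s, ContourIntegrable Γ (f i)) :
    contourIntegral ϰ Γ (fun x => ∑ i ∈ s, f i x) = ∑ i ∈ s, contourIntegral ϰ Γ (f i) := by
  simp only [contourIntegral, Finset.sum_mul]
  rw [Finset.sum_comm]
  exact Finset.sum_congr rfl fun k _ => by
    rw [integral_finsetSum _ fun i hi => hf i hi k, Finset.mul_sum]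

/-- Absolute convergence of the moments of the weight `e^{-V}` along all contours, for the potential
`V` with coefficients `v`. -/
def MomentsConverge (v : ℕ → ℂ) (Γ : Fin d → ℝ → ℂ) : Prop :=
  ∀ q : ℂ[X], ContourIntegrable Γ fun x => Complex.exp (-potential d v x) * q.eval x

/-- The moment functional as a linear map, for a potential whose moments converge. -/
def momentLinear (v : ℕ → ℂ) (ϰ : Fin d → ℂ) (Γ : Fin d → ℝ → ℂ) (hv : MomentsConverge v Γ) :
    ℂ[X] →ₗ[ℂ] ℂ where
  toFun := momentFunctional v ϰ Γ
  map_add' p q := by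
    simp only [momentFunctional, Polynomial.eval_add, mul_add]
    exact contourIntegral_add ϰ (hv p) (hv q)
  map_smul' c p := by
    simp only [momentFunctional, Polynomial.eval_smul, smul_eq_mul, RingHom.id_apply,
      mul_left_comm _ c]
    exact contourIntegral_const_mul ϰ c _

lemma momentLinear_apply (v : ℕ → ℂ) (ϰ : Fin d → ℂ) (hv : MomentsConverge v Γ) (q : ℂ[X]) :
    momentLinear v ϰ Γ hv q =
      contourIntegral ϰ Γ fun x => Complex.exp (-potential d v x) * q.eval x :=
  rfl

variable {cIn cOut : Fin d → ℂ} (hΓ : ∀ k, IsAsymptoticCurve (Γ k) (cIn k) (cOut k)) {v : ℕ → ℂ}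
include hΓ

lemma momentsConverge
    (hv : ∀ k, 0 < (v (d + 1) * cIn k ^ (d + 1)).re ∧ 0 < (v (d + 1) * cOut k ^ (d + 1)).re) :
    MomentsConverge v Γ := fun q k =>
  (hΓ k).integrable_cexp_neg_potential_mul_eval (hv k).1 (hv k).2 q

lemma hasSum_expCoeff_mul_momentFunctional {t : ℕ → ℂ}
    (ht : ∀ k, ‖t (d + 1)‖ * ‖cIn k‖ ^ (d + 1) < (v (d + 1) * cIn k ^ (d + 1)).re ∧
      ‖t (d + 1)‖ * ‖cOut k‖ ^ (d + 1) < (v (d + 1) * cOut k ^ (d + 1)).re)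
    (ϰ : Fin d → ℂ) (q : ℂ[X]) :
    HasSum (fun l => expCoeff d (-t) l * momentFunctional v ϰ Γ (X ^ l * q))
      (momentFunctional (v + t) ϰ Γ q) := by
  have := hasSum_sum (s := Finset.univ) fun k _ =>
    ((hΓ k).hasSum_expCoeff_mul_integral (ht k).1 (ht k).2 q).mul_left (ϰ k)
  simpa only [momentFunctional, contourIntegral, Finset.mul_sum, mul_left_comm] using this

end Contours

section Hankel

variable {R : Type*} [CommRing R]

/-- The `n × n` Hankel matrix of the moments of `L`. -/
def hankel (L : R[X] → R) (n : ℕ) : Matrix (Fin n) (Fin n) R :=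
  Matrix.of fun i j => L (X ^ ((i : ℕ) + j))

lemma sum_perm_sum_perm_sign_mul_prod {m : Type*} [Fintype m] [DecidableEq m] (M : Matrix m m R) :
    ∑ ρ : Equiv.Perm m, ∑ π : Equiv.Perm m,
      (Equiv.Perm.sign π : R) * (Equiv.Perm.sign ρ : R) * ∏ j, M (π j) (ρ j) =
    (Fintype.card m).factorial * M.det := by
  have hrow (ρ : Equiv.Perm m) : ∑ π : Equiv.Perm m,
      (Equiv.Perm.sign π : R) * (Equiv.Perm.sign ρ : R) * ∏ j, M (π j) (ρ j) = M.det := by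
    have hsign : (Equiv.Perm.sign ρ : R) * (Equiv.Perm.sign ρ : R) = 1 := by
      rw [← Int.cast_mul, ← Units.val_mul, Int.units_mul_self, Units.val_one, Int.cast_one]
    rw [← one_mul M.det, ← hsign, mul_assoc, ← Matrix.det_permute', Matrix.det_apply',
      Finset.mul_sum]
    exact Finset.sum_congr rfl fun π _ => by rw [mul_comm (Equiv.Perm.sign π : R), mul_assoc]; rfl
  rw [Finset.sum_congr rfl fun ρ _ => hrow ρ, Finset.sum_const, Finset.card_univ,
    Fintype.card_perm, nsmul_eq_mul]

lemma sq_prod_sub_eq_sum_perm {n : ℕ} (x : Fin n → R) :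
    (∏ i : Fin n, ∏ j ∈ Finset.Ioi i, (x i - x j)) ^ 2 =
      ∑ ρ : Equiv.Perm (Fin n), ∑ π : Equiv.Perm (Fin n),
        (Equiv.Perm.sign π : R) * (Equiv.Perm.sign ρ : R) *
          ∏ j, x j ^ ((π j : ℕ) + ρ j) := by
  have hvandermonde : (∏ i : Fin n, ∏ j ∈ Finset.Ioi i, (x i - x j)) ^ 2 =
      (Matrix.vandermonde x).transpose.det ^ 2 := by
    simp only [Matrix.det_transpose, Matrix.det_vandermonde, ← Finset.prod_pow, sub_sq_comm]
  rw [hvandermonde, sq, Matrix.det_apply', Finset.sum_mul_sum, Finset.sum_comm]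
  refine Finset.sum_congr rfl fun ρ _ => Finset.sum_congr rfl fun π _ => ?_
  simp only [Matrix.transpose_apply, Matrix.vandermonde_apply, pow_add, Finset.prod_mul_distrib]
  ring

end Hankel

section Partition

variable {d : ℕ} {Γ : Fin d → ℝ → ℂ} {v : ℕ → ℂ}

lemma ContourIntegrable.fintype_prod {m : Type*} [Fintype m] {f : m → ℂ → ℂ}
    (hf : ∀ j, ContourIntegrable Γ (f j)) (σ : m → Fin d) :
    Integrable fun s : m → ℝ => ∏ j, (f j (Γ (σ j) (s j)) * deriv (Γ (σ j)) (s j)) :=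
  Integrable.fintype_prod fun j => hf j (σ j)

lemma sum_prod_mul_integral_prod {m : Type*} [Fintype m] [DecidableEq m] (ϰ : Fin d → ℂ)
    (f : m → ℂ → ℂ) :
    ∑ σ : m → Fin d, (∏ j, ϰ (σ j)) *
        ∫ s : m → ℝ, ∏ j, (f j (Γ (σ j) (s j)) * deriv (Γ (σ j)) (s j)) =
      ∏ j, contourIntegral ϰ Γ (f j) := by
  simp only [contourIntegral, Finset.prod_univ_sum, Fintype.piFinset_univ]
  refine Finset.sum_congr rfl fun σ _ => ?_
  rw [Finset.prod_mul_distrib]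
  congr 1
  exact integral_fintype_prod_volume_eq_prod fun j s => f j (Γ (σ j) s) * deriv (Γ (σ j)) s

lemma partitionIntegrand_eq_sum_perm (n : ℕ) (σ : Fin n → Fin d) (s : Fin n → ℝ) :
    partitionIntegrand n v Γ σ s = ∑ ρ : Equiv.Perm (Fin n), ∑ π : Equiv.Perm (Fin n),
      (Equiv.Perm.sign π : ℂ) * (Equiv.Perm.sign ρ : ℂ) *
        ∏ j, (Complex.exp (-potential d v (Γ (σ j) (s j))) *
          (X ^ ((π j : ℕ) + ρ j) : ℂ[X]).eval (Γ (σ j) (s j)) * deriv (Γ (σ j)) (s j)) := by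
  rw [partitionIntegrand, sq_prod_sub_eq_sum_perm, ← Finset.sum_neg_distrib, Complex.exp_sum]
  simp only [Finset.sum_mul, Finset.prod_mul_distrib, eval_pow, eval_X]
  exact Finset.sum_congr rfl fun ρ _ => Finset.sum_congr rfl fun π _ => by ring

lemma integrable_partitionIntegrand (hv : MomentsConverge v Γ) (n : ℕ) (σ : Fin n → Fin d) :
    Integrable (partitionIntegrand n v Γ σ) := by
  simp only [funext (partitionIntegrand_eq_sum_perm n σ)]
  exact integrable_finsetSum _ fun ρ _ => integrable_finsetSum _ fun π _ =>
    (ContourIntegrable.fintype_prod (fun j => hv (X ^ ((π j : ℕ) + ρ j))) σ).const_mul _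

lemma integral_partitionIntegrand (hv : MomentsConverge v Γ) (n : ℕ) (σ : Fin n → Fin d) :
    ∫ s, partitionIntegrand n v Γ σ s =
      ∑ ρ : Equiv.Perm (Fin n), ∑ π : Equiv.Perm (Fin n),
        (Equiv.Perm.sign π : ℂ) * (Equiv.Perm.sign ρ : ℂ) *
          ∫ s : Fin n → ℝ, ∏ j, (Complex.exp (-potential d v (Γ (σ j) (s j))) *
            (X ^ ((π j : ℕ) + ρ j) : ℂ[X]).eval (Γ (σ j) (s j)) * deriv (Γ (σ j)) (s j)) := by
  have hint (ρ π : Equiv.Perm (Fin n)) :=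
    (ContourIntegrable.fintype_prod (fun j => hv (X ^ ((π j : ℕ) + ρ j))) σ).const_mul
      ((Equiv.Perm.sign π : ℂ) * (Equiv.Perm.sign ρ : ℂ))
  simp only [partitionIntegrand_eq_sum_perm]
  rw [integral_finsetSum _ fun ρ _ => integrable_finsetSum _ fun π _ => hint ρ π]
  refine Finset.sum_congr rfl fun ρ _ => ?_
  rw [integral_finsetSum _ fun π _ => hint ρ π]
  exact Finset.sum_congr rfl fun π _ => integral_const_mul _ _

theorem partitionFunction_eq_factorial_mul_det_hankel (hv : MomentsConverge v Γ) (n : ℕ)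
    (ϰ : Fin d → ℂ) :
    partitionFunction n v ϰ Γ = n.factorial * (hankel (momentFunctional v ϰ Γ) n).det := by
  have hdet := sum_perm_sum_perm_sign_mul_prod (hankel (momentFunctional v ϰ Γ) n)
  rw [Fintype.card_fin] at hdet
  rw [partitionFunction, ← hdet]
  simp only [integral_partitionIntegrand hv, Finset.mul_sum]
  rw [Finset.sum_comm]
  refine Finset.sum_congr rfl fun ρ _ => ?_
  rw [Finset.sum_comm]
  refine Finset.sum_congr rfl fun π _ => ?_
  simp only [hankel, Matrix.of_apply, momentFunctional]
  rw [← sum_prod_mul_integral_prod, Finset.mul_sum]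
  exact Finset.sum_congr rfl fun σ _ => mul_left_comm _ _ _

end Partition

section Moments

variable {R : Type*} [CommRing R]

lemma eq_sum_range_coeff_smul_X_pow {f : R[X]} {N : ℕ} (hf : f.degree < N) :
    f = ∑ k ∈ Finset.range N, f.coeff k • (X : R[X]) ^ k := by
  rcases eq_or_ne f 0 with rfl | hne
  · simp
  · simpa only [Polynomial.smul_eq_C_mul] using
      f.as_sum_range_C_mul_X_pow' ((Polynomial.natDegree_lt_iff_degree_lt hne).mpr hf)

lemma of_linearMap_mul_eq_mul_hankel_mul (L : R[X] →ₗ[R] R) {n : ℕ} {p r : Fin n → R[X]}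
    (hp : ∀ j, (p j).degree < n) (hr : ∀ j, (r j).degree < n) :
    (Matrix.of fun i j => L (p i * r j)) =
      (Matrix.of fun k j : Fin n => (p j).coeff k).transpose * hankel L n *
        Matrix.of fun k j : Fin n => (r j).coeff k := by
  ext i j
  conv_lhs => rw [Matrix.of_apply, eq_sum_range_coeff_smul_X_pow (hp i),
    eq_sum_range_coeff_smul_X_pow (hr j)]
  simp only [Matrix.of_apply, Matrix.mul_apply, Matrix.transpose_apply, hankel, Finset.sum_range,
    Finset.mul_sum, Finset.sum_mul, map_sum, smul_mul_smul_comm, map_smul, smul_eq_mul, ← pow_add]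
  exact Finset.sum_congr rfl fun k _ => Finset.sum_congr rfl fun l _ => by ring

lemma det_of_coeff_add_eq_one {w : ℕ → R[X]} {m : ℕ} (hmonic : ∀ j, (w j).Monic)
    (hdeg : ∀ j, (w j).natDegree = m + j) (N : ℕ) :
    (Matrix.of fun i j : Fin N => (w j).coeff (m + i)).det = 1 := by
  have hupper : (Matrix.of fun i j : Fin N => (w j).coeff (m + i)).IsUpperTriangular :=
    fun i j hji => Polynomial.coeff_eq_zero_of_natDegree_lt (by rw [hdeg]; simpa using hji)
  rw [Matrix.det_of_isUpperTriangular hupper]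
  exact Finset.prod_eq_one fun i _ => by rw [Matrix.of_apply, ← hdeg, (hmonic i).coeff_natDegree]

end Moments

section Orthogonal

variable {F : Type*} [Field F]

/-- `p` is the sequence of monic orthogonal polynomials of `L`, with squared norms `h`. -/
structure IsOrthogonal (L : F[X] →ₗ[F] F) (p : ℕ → F[X]) (h : ℕ → F) : Prop where
  monic : ∀ j, (p j).Monic
  natDegree_eq : ∀ j, (p j).natDegree = j
  h_ne_zero : ∀ j, h j ≠ 0
  orthogonal : ∀ i j, L (p i * p j) = if i = j then h i else 0

/-- Integration of the Christoffel–Darboux kernel `∑_{j<n} p_j(z) p_j(w) / h_j` against `L` in the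
variable `w`.  If `p` and `h` belong to `L`, this is the orthogonal projection to the polynomials of
degree less than `n`; it is also used for other functionals, namely the deformations of `L`. -/
def christoffelDarboux (L : F[X] →ₗ[F] F) (p : ℕ → F[X]) (h : ℕ → F) (n : ℕ) : F[X] →ₗ[F] F[X] :=
  ∑ j ∈ Finset.range n, ((h j)⁻¹ • L ∘ₗ LinearMap.mulRight F (p j)).smulRight (p j)

lemma christoffelDarboux_apply (L : F[X] →ₗ[F] F) (p : ℕ → F[X]) (h : ℕ → F) (n : ℕ) (f : F[X]) :
    christoffelDarboux L p h n f = ∑ j ∈ Finset.range n, ((h j)⁻¹ * L (f * p j)) • p j := by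
  simp [christoffelDarboux]

namespace IsOrthogonal

variable {L : F[X] →ₗ[F] F} {p : ℕ → F[X]} {h : ℕ → F} (H : IsOrthogonal L p h)

include H

lemma degree_eq (j : ℕ) : (p j).degree = j := by
  rw [Polynomial.degree_eq_natDegree (H.monic j).ne_zero, H.natDegree_eq]

lemma degree_lt {j n : ℕ} (hj : j < n) : (p j).degree < n := by
  rw [H.degree_eq]
  exact_mod_cast hj

lemma linearIndependent : LinearIndependent F p :=
  (⟨p, H.degree_eq⟩ : Polynomial.Sequence F).linearIndependent

lemma span_image_Iio (n : ℕ) : Submodule.span F (p '' Set.Iio n) = degreeLT F n :=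
  (⟨p, H.degree_eq⟩ : Polynomial.Sequence F).span_degreeLT fun i _ => by
    change IsUnit (p i).leadingCoeff
    rw [(H.monic i).leadingCoeff]
    exact isUnit_one

lemma degree_christoffelDarboux_lt (L' : F[X] →ₗ[F] F) (n : ℕ) (f : F[X]) :
    (christoffelDarboux L' p h n f).degree < n := by
  rw [christoffelDarboux_apply, ← Polynomial.mem_degreeLT]
  exact Submodule.sum_mem _ fun j hj => Submodule.smul_mem _ _
    (Polynomial.mem_degreeLT.mpr (H.degree_lt (Finset.mem_range.mp hj)))

lemma christoffelDarboux_apply_self (n i : ℕ) :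
    christoffelDarboux L p h n (p i) = if i < n then p i else 0 := by
  simp only [christoffelDarboux_apply, H.orthogonal, mul_ite, mul_zero, ite_smul, zero_smul,
    Finset.sum_ite_eq, Finset.mem_range]
  split_ifs
  · rw [inv_mul_cancel₀ (H.h_ne_zero i), one_smul]
  · rfl

lemma christoffelDarboux_of_degree_lt {n : ℕ} {f : F[X]} (hf : f.degree < n) :
    christoffelDarboux L p h n f = f := by
  have hbasis : Set.EqOn (christoffelDarboux L p h n) (LinearMap.id : F[X] →ₗ[F] F[X])
      (p '' Set.Iio n) := by
    rintro _ ⟨i, hi, rfl⟩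
    rw [H.christoffelDarboux_apply_self, if_pos (Set.mem_Iio.mp hi), LinearMap.id_apply]
  have hspan := LinearMap.eqOn_span hbasis
  rw [H.span_image_Iio] at hspan
  exact hspan (Polynomial.mem_degreeLT.mpr hf)

lemma det_christoffelDarboux (L' : F[X] →ₗ[F] F) (n : ℕ) :
    (Matrix.of fun a b : Fin n => (christoffelDarboux L' p h n (X ^ (b : ℕ))).coeff a).det =
      (hankel L' n).det / ∏ j ∈ Finset.range n, h j := by
  have hfactor :
      (Matrix.of fun a b : Fin n => (christoffelDarboux L' p h n (X ^ (b : ℕ))).coeff a) =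
        (Matrix.of fun k j : Fin n => (p j).coeff k) * Matrix.diagonal (fun j : Fin n => (h j)⁻¹) *
          Matrix.of fun i b : Fin n => L' (p i * X ^ (b : ℕ)) := by
    ext a b
    rw [Matrix.mul_apply]
    simp only [Matrix.mul_diagonal, Matrix.of_apply, christoffelDarboux_apply,
      Polynomial.finsetSum_coeff, Polynomial.coeff_smul, smul_eq_mul, Finset.sum_range]
    exact Finset.sum_congr rfl fun j _ => by rw [mul_comm (p j)]; ring
  have hP : (Matrix.of fun k j : Fin n => (p j).coeff k).det = 1 :=
    Matrix.det_matrixOfPolynomials _ (fun j => H.natDegree_eq j) fun j => H.monic j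
  have hX : (Matrix.of fun k b : Fin n => ((X : F[X]) ^ (b : ℕ)).coeff k).det = 1 :=
    Matrix.det_matrixOfPolynomials _ (fun b => natDegree_X_pow _) fun b => monic_X_pow _
  rw [hfactor, of_linearMap_mul_eq_mul_hankel_mul L' (fun j => H.degree_lt j.2) fun b => by simp]
  simp only [Matrix.det_mul, Matrix.det_transpose, Matrix.det_diagonal, hP, hX,
    Finset.prod_inv_distrib, one_mul, mul_one]
  rw [Finset.prod_range, div_eq_inv_mul]

lemma det_hankel (n : ℕ) : (hankel L n).det = ∏ j ∈ Finset.range n, h j := by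
  have hone :
      (Matrix.of fun a b : Fin n => (christoffelDarboux L p h n (X ^ (b : ℕ))).coeff a) = 1 := by
    ext a b
    rw [Matrix.of_apply, H.christoffelDarboux_of_degree_lt (by simp), coeff_X_pow,
      Matrix.one_apply]
    simp only [Fin.val_inj]
  have hdet := H.det_christoffelDarboux L n
  rw [hone, Matrix.det_one] at hdet
  exact (eq_of_div_eq_one hdet.symm)

end IsOrthogonal

end Orthogonal

section InitialSubspace

variable {L : ℂ[X] →ₗ[ℂ] ℂ} {p : ℕ → ℂ[X]} {h : ℕ → ℂ}

lemma coeff_projOn (n : ℕ) (W : Submodule ℂ ℂ[X]) (f : W) (k : ℕ) :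
    (projOn n W f : ℂ[X]).coeff k = if k < n then 0 else (f : ℂ[X]).coeff k := by
  simp only [projOn, projPlus, LinearMap.comp_apply, Submodule.subtype_apply, LinearMap.coe_mk,
    AddHom.coe_mk, Polynomial.coeff_sub, Polynomial.finsetSum_coeff, Polynomial.coeff_monomial,
    Finset.sum_ite_eq', Finset.mem_range]
  split_ifs <;> ring

namespace IsOrthogonal

variable (H : IsOrthogonal L p h)

include H

lemma initialSubspace_eq_ker (n : ℕ) :
    initialSubspace n p = LinearMap.ker (christoffelDarboux L p h n) := by
  refine le_antisymm (Submodule.span_le.mpr ?_) fun f hf => ?_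
  · rintro _ ⟨i, hi, rfl⟩
    rw [SetLike.mem_coe, LinearMap.mem_ker, H.christoffelDarboux_apply_self, if_neg (not_lt.mpr hi)]
  · have hdeg : f.degree < (n + (f.natDegree + 1) : ℕ) :=
      Polynomial.degree_le_natDegree.trans_lt (by exact_mod_cast (by omega))
    rw [← H.christoffelDarboux_of_degree_lt hdeg, christoffelDarboux_apply, Finset.sum_range_add,
      ← christoffelDarboux_apply, LinearMap.mem_ker.mp hf, zero_add]
    exact Submodule.sum_mem _ fun j _ => Submodule.smul_mem _ _
      (Submodule.subset_span ⟨n + j, n.le_add_right j, rfl⟩)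

lemma coeff_eq_neg_sum_coeff_christoffelDarboux {n N : ℕ} {f : ℂ[X]}
    (hf : f ∈ initialSubspace n p) (hdeg : f.natDegree < n + N) {a : ℕ} (ha : a < n) :
    f.coeff a = -∑ l ∈ Finset.range N,
      f.coeff (n + l) * (christoffelDarboux L p h n (X ^ (n + l))).coeff a := by
  have hlow : ∑ k ∈ Finset.range n, f.coeff k * (christoffelDarboux L p h n (X ^ k)).coeff a =
      f.coeff a := by
    rw [Finset.sum_congr rfl fun k hk => by
      rw [H.christoffelDarboux_of_degree_lt (by simpa using hk), coeff_X_pow]]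
    simp [ha]
  rw [H.initialSubspace_eq_ker, LinearMap.mem_ker, eq_sum_range_coeff_smul_X_pow (f := f)
    (Polynomial.degree_le_natDegree.trans_lt (by exact_mod_cast hdeg)), map_sum,
    Finset.sum_range_add] at hf
  have hcoeff := congrArg (fun q : ℂ[X] => q.coeff a) hf
  simp only [map_smul, Polynomial.coeff_add, Polynomial.finsetSum_coeff, Polynomial.coeff_smul,
    Polynomial.coeff_zero, smul_eq_mul, hlow] at hcoeff
  exact eq_neg_of_add_eq_zero_left hcoeff

lemma isAdmissibleFrame (n : ℕ) :
    IsAdmissibleFrame n (initialSubspace n p) fun j => p (n + j) where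
  linearIndependent := H.linearIndependent.comp _ (add_right_injective n)
  span_eq := by
    have hrange : Set.range (fun j => n + j) = {j | n ≤ j} :=
      Set.ext fun j => ⟨by rintro ⟨k, rfl⟩; exact n.le_add_right k,
        fun hj => ⟨j - n, Nat.add_sub_cancel' hj⟩⟩
    rw [initialSubspace, ← hrange, ← Set.range_comp]
    rfl
  monic j := H.monic _
  natDegree_eq j := H.natDegree_eq _

lemma projOn_bijective (n : ℕ) : Function.Bijective (projOn n (initialSubspace n p)) := by
  constructor
  · refine LinearMap.ker_eq_bot.mp (LinearMap.ker_eq_bot'.mpr ?_)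
    rintro ⟨f, hf⟩ hproj
    have hdeg : f.degree < n := (Polynomial.degree_lt_iff_coeff_zero f n).mpr fun k hk => by
      have := coeff_projOn n (initialSubspace n p) ⟨f, hf⟩ k
      rw [hproj, if_neg (not_lt.mpr hk)] at this
      simpa using this.symm
    rw [H.initialSubspace_eq_ker, LinearMap.mem_ker, H.christoffelDarboux_of_degree_lt hdeg] at hf
    exact Subtype.ext hf
  · rintro ⟨g, hg⟩
    have hdeg := H.degree_christoffelDarboux_lt L n g
    refine ⟨⟨g - christoffelDarboux L p h n g, ?_⟩, Subtype.ext (Polynomial.ext fun k => ?_)⟩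
    · rw [H.initialSubspace_eq_ker, LinearMap.mem_ker, map_sub,
        H.christoffelDarboux_of_degree_lt hdeg, sub_self]
    · rw [coeff_projOn]
      split_ifs with hk
      · exact (hg k hk).symm
      · rw [coeff_sub, (Polynomial.degree_lt_iff_coeff_zero _ n).mp hdeg k (not_lt.mp hk), sub_zero]

lemma inGrassmannian (n : ℕ) : InGrassmannian n (initialSubspace n p) := by
  obtain ⟨hinj, hsurj⟩ := H.projOn_bijective n
  rw [InGrassmannian, LinearMap.ker_eq_bot.mpr hinj, LinearMap.range_eq_top.mpr hsurj]
  exact ⟨inferInstance, inferInstance⟩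

end IsOrthogonal

end InitialSubspace

section Fredholm

lemma det_id_sub_comp_comm {R V W : Type*} [CommRing R] [AddCommGroup V] [Module R V]
    [Module.Free R V] [Module.Finite R V] [AddCommGroup W] [Module R W] [Module.Free R W]
    [Module.Finite R W] (a : W →ₗ[R] V) (b : V →ₗ[R] W) :
    LinearMap.det (LinearMap.id - a ∘ₗ b) = LinearMap.det (LinearMap.id - b ∘ₗ a) := by
  classical
  let bV := Module.Free.chooseBasis R V
  let bW := Module.Free.chooseBasis R W
  rw [← LinearMap.det_toMatrix bV, ← LinearMap.det_toMatrix bW, map_sub, map_sub,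
    LinearMap.toMatrix_id, LinearMap.toMatrix_id, LinearMap.toMatrix_comp bV bW bV,
    LinearMap.toMatrix_comp bW bV bW, Matrix.det_one_sub_mul_comm]

variable {E : Type*} [AddCommGroup E] [Module ℂ E]

lemma fredholmDet_comp {F : Type*} [AddCommGroup F] [Module ℂ F] [Module.Finite ℂ F]
    (Φ : F →ₗ[ℂ] E) (Λ : E →ₗ[ℂ] F) :
    fredholmDet (Φ ∘ₗ Λ) = LinearMap.det (LinearMap.id - Λ ∘ₗ Φ) := by
  have hfin : Module.Finite ℂ (LinearMap.range (Φ ∘ₗ Λ)) :=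
    Module.Finite.of_injective (Submodule.inclusion (LinearMap.range_comp_le_range Λ Φ))
      (Submodule.inclusion_injective _)
  let Ψ : LinearMap.range Λ →ₗ[ℂ] LinearMap.range (Φ ∘ₗ Λ) :=
    (Φ ∘ₗ (LinearMap.range Λ).subtype).codRestrict _ (by
      rintro ⟨_, e, rfl⟩
      exact ⟨e, rfl⟩)
  have hΨ : (Φ ∘ₗ Λ).rangeRestrict = Ψ ∘ₗ Λ.rangeRestrict := rfl
  have hΨ' : (LinearMap.range (Φ ∘ₗ Λ)).subtype ∘ₗ Ψ = Φ ∘ₗ (LinearMap.range Λ).subtype := rfl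
  have hΛ : (LinearMap.range Λ).subtype ∘ₗ Λ.rangeRestrict = Λ := rfl
  rw [fredholmDet, hΨ, LinearMap.comp_assoc, det_id_sub_comp_comm, LinearMap.comp_assoc, hΨ',
    ← LinearMap.comp_assoc, det_id_sub_comp_comm, ← LinearMap.comp_assoc, hΛ]

/-- The operator `f ↦ ∑_j ℓ_j(f) φ_j` of finite rank. -/
def finiteRankOperator {n : ℕ} (ℓ : Fin n → E →ₗ[ℂ] ℂ) (φ : Fin n → E) : E →ₗ[ℂ] E :=
  Fintype.linearCombination ℂ φ ∘ₗ LinearMap.pi ℓ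

variable {n : ℕ} (ℓ : Fin n → E →ₗ[ℂ] ℂ) (φ : Fin n → E)

lemma finiteRankOperator_apply (f : E) : finiteRankOperator ℓ φ f = ∑ j, ℓ j f • φ j := by
  simp [finiteRankOperator, Fintype.linearCombination_apply]

lemma range_finiteRankOperator_le :
    LinearMap.range (finiteRankOperator ℓ φ) ≤ LinearMap.range (Fintype.linearCombination ℂ φ) :=
  LinearMap.range_comp_le_range _ _

lemma finite_range_finiteRankOperator :
    Module.Finite ℂ (LinearMap.range (finiteRankOperator ℓ φ)) :=
  Module.Finite.of_injective (Submodule.inclusion (range_finiteRankOperator_le ℓ φ))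
    (Submodule.inclusion_injective _)

lemma finrank_range_finiteRankOperator_le :
    Module.finrank ℂ (LinearMap.range (finiteRankOperator ℓ φ)) ≤ n := by
  simpa using (Submodule.finrank_mono (range_finiteRankOperator_le ℓ φ)).trans
    (LinearMap.finrank_range_le _)

lemma fredholmDet_finiteRankOperator :
    fredholmDet (finiteRankOperator ℓ φ) = (1 - Matrix.of fun i j => ℓ i (φ j)).det := by
  rw [finiteRankOperator, fredholmDet_comp, ← LinearMap.det_toMatrix', map_sub,
    LinearMap.toMatrix'_id]
  congr 2
  ext i j
  simp [LinearMap.toMatrix'_apply]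

end Fredholm

section Truncation

/-- The upper left `N × N` block of an infinite matrix. -/
def trunc (N : ℕ) (M : Matrix ℕ ℕ ℂ) : Matrix (Fin N) (Fin N) ℂ := M.submatrix Fin.val Fin.val

/-- The first `N` rows of the lower left block of an infinite matrix (rows with index at least `n`,
columns with index less than `n`). -/
def lowerLeftTrunc (n N : ℕ) (M : Matrix ℕ ℕ ℂ) : Matrix (Fin N) (Fin n) ℂ :=
  M.submatrix (fun i => n + i) Fin.val

lemma triInv_apply (M : Matrix ℕ ℕ ℂ) {i j N : ℕ} (hN : max i j + 1 = N) (hi : i < N)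
    (hj : j < N) : triInv M i j = (trunc N M)⁻¹ ⟨i, hi⟩ ⟨j, hj⟩ := by
  subst hN
  rfl

lemma sum_mul_triInv {M : Matrix ℕ ℕ ℂ} {l : ℕ} (hM : IsUnit (trunc (l + 1) M).det)
    {b : ℕ} (hb : b ≤ l) :
    ∑ m ∈ Finset.range (l + 1), M b m * triInv M m l = if b = l then 1 else 0 := by
  have hinv := congrFun₂ (Matrix.mul_nonsing_inv _ hM) ⟨b, by omega⟩ ⟨l, by omega⟩
  simp only [Matrix.mul_apply, Matrix.one_apply, Fin.mk.injEq] at hinv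
  rw [← hinv, Finset.sum_range]
  exact Finset.sum_congr rfl fun m _ => by rw [triInv_apply M (by omega) m.2 l.lt_succ_self]; rfl

variable (d : ℕ) (t : ℕ → ℂ)

lemma plusBlock_flowMatrix (n : ℕ) : plusBlock n (flowMatrix d t) = flowMatrix d t := by
  ext i j
  exact flowMatrix_add_add d t n i j

lemma det_trunc_flowMatrix (N : ℕ) : (trunc N (flowMatrix d t)).det = 1 := by
  have hlower : (trunc N (flowMatrix d t)).IsLowerTriangular :=
    fun i j hij => flowMatrix_of_lt d t hij
  rw [Matrix.det_of_isLowerTriangular _ hlower]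
  exact Finset.prod_eq_one fun i _ => flowMatrix_self d t i

lemma trunc_flowMatrix_neg_mul_trunc (N : ℕ) :
    trunc N (flowMatrix d (-t)) * trunc N (flowMatrix d t) = 1 := by
  ext a b
  simp only [Matrix.mul_apply, trunc, Matrix.submatrix_apply, Matrix.one_apply, ← Fin.val_inj]
  rw [← sum_flowMatrix_neg_mul_flowMatrix d t a.2 b, Finset.sum_range]

lemma trunc_flowMatrix_neg_mul_lowerLeftTrunc (n N : ℕ) :
    trunc N (flowMatrix d (-t)) * lowerLeftTrunc n N (flowMatrix d t) =
      -(lowerLeftTrunc n N (flowMatrix d (-t)) * trunc n (flowMatrix d t)) := by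
  ext i b
  have hsum := sum_flowMatrix_neg_mul_flowMatrix d t (i := n + i) (N := n + N) (by omega) b
  rw [Finset.sum_range_add, if_neg (by omega), Finset.sum_range, Finset.sum_range] at hsum
  simp only [flowMatrix_add_add] at hsum
  exact eq_neg_of_add_eq_zero_right hsum

lemma triInv_plusBlock_flowMatrix (n : ℕ) :
    triInv (plusBlock n (flowMatrix d t)) = flowMatrix d (-t) := by
  ext i j
  rw [plusBlock_flowMatrix, triInv_apply _ rfl (by omega) (by omega),
    Matrix.inv_eq_left_inv (trunc_flowMatrix_neg_mul_trunc d t _)]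
  rfl

end Truncation

section GraphMatrix

/-- The first `N` columns of the matrix `W_{n+} W_+⁻¹`. -/
def graphTrunc (n N : ℕ) (p : ℕ → ℂ[X]) : Matrix (Fin n) (Fin N) ℂ :=
  Matrix.of fun a l => graphMatrix n p a l

namespace IsOrthogonal

variable {L : ℂ[X] →ₗ[ℂ] ℂ} {p : ℕ → ℂ[X]} {h : ℕ → ℂ} (H : IsOrthogonal L p h)

include H

lemma isUnit_det_trunc_plusBlock_polyMatrix (n N : ℕ) :
    IsUnit (trunc N (plusBlock n (polyMatrix p))).det := by
  have hdet := det_of_coeff_add_eq_one (w := fun j => p (n + j)) (fun j => H.monic _)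
    (fun j => H.natDegree_eq _) N
  exact (show (trunc N (plusBlock n (polyMatrix p))).det = 1 from hdet) ▸ isUnit_one

lemma graphMatrix_eq_neg_coeff {n a : ℕ} (ha : a < n) (l : ℕ) :
    graphMatrix n p a l = -(christoffelDarboux L p h n (X ^ (n + l))).coeff a := by
  have hcol : ∀ m ∈ Finset.range (l + 1), polyMatrix p a (n + m) =
      ∑ b ∈ Finset.range (l + 1), -(christoffelDarboux L p h n (X ^ (n + b))).coeff a *
        plusBlock n (polyMatrix p) b m := fun m hm => by
    have hmem : p (n + m) ∈ initialSubspace n p :=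
      Submodule.subset_span ⟨n + m, n.le_add_right m, rfl⟩
    refine (H.coeff_eq_neg_sum_coeff_christoffelDarboux hmem (N := l + 1)
      (by rw [H.natDegree_eq]; simpa using hm) ha).trans ?_
    rw [← Finset.sum_neg_distrib]
    exact Finset.sum_congr rfl fun b _ => by rw [neg_mul, mul_comm]; rfl
  rw [graphMatrix, Finset.sum_congr rfl fun m hm => by rw [hcol m hm, Finset.sum_mul],
    Finset.sum_comm]
  simp only [mul_assoc, ← Finset.mul_sum]
  rw [Finset.sum_congr rfl fun b hb => by
    rw [sum_mul_triInv (H.isUnit_det_trunc_plusBlock_polyMatrix n (l + 1))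
      (Finset.mem_range_succ_iff.mp hb)]]
  simp

lemma coeff_eq_sum_graphMatrix {n N : ℕ} {f : ℂ[X]} (hf : f ∈ initialSubspace n p)
    (hdeg : f.natDegree < n + N) {a : ℕ} (ha : a < n) :
    f.coeff a = ∑ l ∈ Finset.range N, graphMatrix n p a l * f.coeff (n + l) := by
  rw [H.coeff_eq_neg_sum_coeff_christoffelDarboux hf hdeg ha, ← Finset.sum_neg_distrib]
  exact Finset.sum_congr rfl fun l _ => by
    rw [H.graphMatrix_eq_neg_coeff ha l, neg_mul, mul_comm]

lemma trunc_flowedPlusBlock (d : ℕ) (t : ℕ → ℂ) {n : ℕ} {w : ℕ → ℂ[X]}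
    (hw : IsAdmissibleFrame n (initialSubspace n p) w) (N : ℕ) :
    trunc N (flowedPlusBlock d n t w) =
      (lowerLeftTrunc n N (flowMatrix d t) * graphTrunc n N p + trunc N (flowMatrix d t)) *
        Matrix.of fun i j : Fin N => (w j).coeff (n + i) := by
  ext i j
  have hdeg : (w j).natDegree < n + N := by
    rw [hw.natDegree_eq]
    omega
  have hmem : w j ∈ initialSubspace n p := by
    rw [← hw.span_eq]
    exact Submodule.subset_span ⟨j, rfl⟩
  have hcoeff := taylorCoeff_flow_eval d t (q := w j) (N := n + N)
    (Polynomial.degree_le_natDegree.trans_lt (by exact_mod_cast hdeg)) (n + i)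
  rw [Finset.sum_range_add, Finset.sum_range, Finset.sum_range] at hcoeff
  simp only [flowMatrix_add_add] at hcoeff
  rw [add_mul, Matrix.mul_assoc, Matrix.add_apply, Matrix.mul_apply, Matrix.mul_apply]
  refine hcoeff.trans (congrArg₂ _ (Finset.sum_congr rfl fun a _ => ?_) rfl)
  rw [H.coeff_eq_sum_graphMatrix hmem hdeg a.2, Finset.sum_range, Matrix.mul_apply]
  rfl

lemma det_trunc_flowedPlusBlock (d : ℕ) (t : ℕ → ℂ) {n : ℕ} {w : ℕ → ℂ[X]}
    (hw : IsAdmissibleFrame n (initialSubspace n p) w) (N : ℕ) :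
    (trunc N (flowedPlusBlock d n t w)).det =
      (1 - graphTrunc n N p * lowerLeftTrunc n N (flowMatrix d (-t)) *
        trunc n (flowMatrix d t)).det := by
  rw [H.trunc_flowedPlusBlock d t hw, Matrix.det_mul,
    det_of_coeff_add_eq_one hw.monic hw.natDegree_eq, mul_one, ← one_mul (Matrix.det _),
    ← det_trunc_flowMatrix d (-t) N, ← Matrix.det_mul, mul_add, trunc_flowMatrix_neg_mul_trunc,
    ← Matrix.mul_assoc, trunc_flowMatrix_neg_mul_lowerLeftTrunc, Matrix.neg_mul, neg_add_eq_sub,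
    Matrix.det_one_sub_mul_comm, Matrix.mul_assoc]

end IsOrthogonal

end GraphMatrix

section InfiniteDet

variable {d : ℕ} {t : ℕ → ℂ} {L L' : ℂ[X] →ₗ[ℂ] ℂ} {p : ℕ → ℂ[X]} {h : ℕ → ℂ}

lemma hasSum_flowMatrix_neg_mul
    (hL' : ∀ q : ℂ[X], HasSum (fun l => expCoeff d (-t) l * L (X ^ l * q)) (L' q))
    (b : ℕ) (q : ℂ[X]) :
    HasSum (fun m => flowMatrix d (-t) m b * L (X ^ m * q)) (L' (X ^ b * q)) := by
  rw [← hasSum_nat_add_iff' b, Finset.sum_eq_zero fun i hi => by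
    rw [flowMatrix_of_lt d _ (Finset.mem_range.mp hi), zero_mul], sub_zero]
  refine (hL' (X ^ b * q)).congr_fun fun l => ?_
  rw [flowMatrix_apply, if_pos (by omega), Nat.add_sub_cancel, pow_add, mul_assoc]

lemma hasSum_flowMatrix_neg_mul_coeff_christoffelDarboux
    (hL' : ∀ q : ℂ[X], HasSum (fun l => expCoeff d (-t) l * L (X ^ l * q)) (L' q))
    (n a b : ℕ) :
    HasSum (fun m => flowMatrix d (-t) m b * (christoffelDarboux L p h n (X ^ m)).coeff a)
      ((christoffelDarboux L' p h n (X ^ b)).coeff a) := by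
  have hsum := hasSum_sum (s := Finset.range n) fun j _ =>
    ((hasSum_flowMatrix_neg_mul hL' b (p j)).mul_left (h j)⁻¹).mul_right ((p j).coeff a)
  simp only [christoffelDarboux_apply, Polynomial.finsetSum_coeff, Polynomial.coeff_smul,
    smul_eq_mul, Finset.mul_sum]
  refine hsum.congr_fun fun m => Finset.sum_congr rfl fun j _ => ?_
  ring

namespace IsOrthogonal

variable (H : IsOrthogonal L p h)
  (hL' : ∀ q : ℂ[X], HasSum (fun l => expCoeff d (-t) l * L (X ^ l * q)) (L' q))

include H hL'

lemma hasSum_graphMatrix_mul_flowMatrix_neg {n a : ℕ} (ha : a < n) (b : ℕ) :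
    HasSum (fun l => graphMatrix n p a l * flowMatrix d (-t) (n + l) b)
      (flowMatrix d (-t) a b - (christoffelDarboux L' p h n (X ^ b)).coeff a) := by
  have hlow : ∑ m ∈ Finset.range n, flowMatrix d (-t) m b *
      (christoffelDarboux L p h n (X ^ m)).coeff a = flowMatrix d (-t) a b := by
    rw [Finset.sum_congr rfl fun m hm => by
      rw [H.christoffelDarboux_of_degree_lt (by simpa using hm), coeff_X_pow]]
    simp [ha]
  have hsum := ((hasSum_nat_add_iff' n).mpr
    (hasSum_flowMatrix_neg_mul_coeff_christoffelDarboux (p := p) (h := h) hL' n a b)).neg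
  rw [hlow, neg_sub] at hsum
  refine hsum.congr_fun fun l => ?_
  rw [H.graphMatrix_eq_neg_coeff ha, add_comm l n]
  ring

lemma tendsto_graphTrunc_mul_lowerLeftTrunc (n : ℕ) :
    Tendsto (fun N => graphTrunc n N p * lowerLeftTrunc n N (flowMatrix d (-t))) atTop
      (𝓝 (trunc n (flowMatrix d (-t)) -
        Matrix.of fun a b : Fin n => (christoffelDarboux L' p h n (X ^ (b : ℕ))).coeff a)) := by
  refine tendsto_pi_nhds.mpr fun a => tendsto_pi_nhds.mpr fun b => ?_
  refine (H.hasSum_graphMatrix_mul_flowMatrix_neg hL' a.2 b).tendsto_sum_nat.congr fun N => ?_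
  rw [Finset.sum_range]
  rfl

theorem hasInfiniteDet_flowedPlusBlock {n : ℕ} {w : ℕ → ℂ[X]}
    (hw : IsAdmissibleFrame n (initialSubspace n p) w) :
    HasInfiniteDet (flowedPlusBlock d n t w)
      ((hankel L' n).det / ∏ j ∈ Finset.range n, h j) := by
  have hcont : Continuous fun S : Matrix (Fin n) (Fin n) ℂ =>
      (1 - S * trunc n (flowMatrix d t)).det := by fun_prop
  have hlim := (hcont.tendsto _).comp (H.tendsto_graphTrunc_mul_lowerLeftTrunc hL' n)
  rw [sub_mul, trunc_flowMatrix_neg_mul_trunc, sub_sub_cancel, Matrix.det_mul,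
    det_trunc_flowMatrix, mul_one, H.det_christoffelDarboux L' n] at hlim
  exact hlim.congr fun N => (H.det_trunc_flowedPlusBlock d t hw N).symm

lemma isKPTau (n : ℕ) : IsKPTau d n (initialSubspace n p) t
    ((hankel L' n).det / ∏ j ∈ Finset.range n, h j) :=
  ⟨⟨_, H.isAdmissibleFrame n⟩, fun _ hw => H.hasInfiniteDet_flowedPlusBlock hL' hw⟩

end IsOrthogonal

end InfiniteDet

section TaylorTail

/-- The part of degree less than `n` of the Taylor series of `f`. -/
def lowPart (n : ℕ) (f : ℂ → ℂ) : ℂ[X] := ∑ j ∈ Finset.range n, monomial j (taylorCoeff f j)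

lemma coeff_lowPart (n : ℕ) (f : ℂ → ℂ) (k : ℕ) :
    (lowPart n f).coeff k = if k < n then taylorCoeff f k else 0 := by
  simp [lowPart, Polynomial.finsetSum_coeff, Polynomial.coeff_monomial]

lemma degree_lowPart_lt (n : ℕ) (f : ℂ → ℂ) : (lowPart n f).degree < n :=
  (Polynomial.degree_lt_iff_coeff_zero _ _).mpr fun k hk => by
    rw [coeff_lowPart, if_neg (not_lt.mpr hk)]

lemma tailPart_eq_sub_eval_lowPart (n : ℕ) (f : ℂ → ℂ) :
    tailPart n f = fun z => f z - (lowPart n f).eval z := by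
  funext z
  simp [tailPart, lowPart, Polynomial.eval_finsetSum]

lemma differentiable_tailPart (n : ℕ) {f : ℂ → ℂ} (hf : Differentiable ℂ f) :
    Differentiable ℂ (tailPart n f) := by
  rw [tailPart_eq_sub_eval_lowPart]
  exact hf.sub (lowPart n f).differentiable

lemma taylorCoeff_tailPart (n : ℕ) {f : ℂ → ℂ} (hf : AnalyticAt ℂ f 0) (k : ℕ) :
    taylorCoeff (tailPart n f) k = if k < n then 0 else taylorCoeff f k := by
  rw [tailPart_eq_sub_eval_lowPart,
    taylorCoeff_sub hf ((lowPart n f).differentiable.analyticAt 0), taylorCoeff_eval,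
    coeff_lowPart]
  split_ifs <;> simp

lemma det_coeff_lowPart_flow (d : ℕ) (t : ℕ → ℂ) {p : ℕ → ℂ[X]} (hmonic : ∀ j, (p j).Monic)
    (hdeg : ∀ j, (p j).natDegree = j) (n : ℕ) :
    (Matrix.of fun a j : Fin n =>
      (lowPart n (flow d t fun z => (p j).eval z)).coeff a).det = 1 := by
  have hfactor : (Matrix.of fun a j : Fin n =>
      (lowPart n (flow d t fun z => (p j).eval z)).coeff a) =
        trunc n (flowMatrix d t) * Matrix.of fun k j : Fin n => (p j).coeff k := by
    ext a j
    rw [Matrix.of_apply, coeff_lowPart, if_pos a.2, Matrix.mul_apply,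
      taylorCoeff_flow_eval d t (Polynomial.degree_le_natDegree.trans_lt
        (by rw [hdeg]; exact_mod_cast j.2)), Finset.sum_range]
    rfl
  rw [hfactor, Matrix.det_mul, det_trunc_flowMatrix, one_mul]
  exact Matrix.det_matrixOfPolynomials _ (fun j => hdeg j) fun j => hmonic j

end TaylorTail

section WeightedIntegral

variable {d : ℕ} {Γ : Fin d → ℝ → ℂ} {v : ℕ → ℂ}

lemma contourIntegrable_of_mem_hPlus {n : ℕ} {f : ℂ → ℂ} (hf : f ∈ hPlus n v Γ) (q : ℂ[X]) :
    ContourIntegrable Γ fun x => Complex.exp (-potential d v x) * q.eval x * f x := by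
  intro k
  induction q using Polynomial.induction_on' with
  | add p q hp hq =>
    refine (hp.add hq).congr (Eventually.of_forall fun s => ?_)
    simp only [Pi.add_apply, Polynomial.eval_add]
    ring
  | monomial m a =>
    refine ((hf.2.2 k m).const_mul a).congr (Eventually.of_forall fun s => ?_)
    simp only [Polynomial.eval_monomial]
    ring

lemma pow_mem_hPlus (hv : MomentsConverge v Γ) (n k : ℕ) :
    (fun z : ℂ => z ^ (n + k)) ∈ hPlus n v Γ := by
  refine ⟨differentiable_pow _, fun j hj => ?_, fun i m => ?_⟩
  · rw [taylorCoeff_pow, if_neg (by omega)]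
  · refine (hv (X ^ (n + k) * X ^ m) i).congr (Eventually.of_forall fun s => ?_)
    simp only [Polynomial.eval_mul, Polynomial.eval_pow, Polynomial.eval_X]
    ring

/-- The functional `f ↦ ∫_{ϰΓ} e^{-V(x)} q(x) f(x) dx` on the completion of `H_+`. -/
def weightedIntegral (n : ℕ) (v : ℕ → ℂ) (ϰ : Fin d → ℂ) (Γ : Fin d → ℝ → ℂ) (q : ℂ[X]) :
    hPlus n v Γ →ₗ[ℂ] ℂ where
  toFun f := contourIntegral ϰ Γ fun x =>
    Complex.exp (-potential d v x) * q.eval x * (f : ℂ → ℂ) x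
  map_add' f g := by
    simp only [Submodule.coe_add, Pi.add_apply, mul_add]
    exact contourIntegral_add ϰ (contourIntegrable_of_mem_hPlus f.2 q)
      (contourIntegrable_of_mem_hPlus g.2 q)
  map_smul' c f := by
    simp only [Submodule.coe_smul, Pi.smul_apply, smul_eq_mul, RingHom.id_apply,
      mul_left_comm _ c]
    exact contourIntegral_const_mul ϰ c _

lemma weightedIntegral_apply (n : ℕ) (ϰ : Fin d → ℂ) (q : ℂ[X]) (f : hPlus n v Γ) :
    weightedIntegral n v ϰ Γ q f =
      contourIntegral ϰ Γ fun x => Complex.exp (-potential d v x) * q.eval x * (f : ℂ → ℂ) x :=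
  rfl

lemma weightedIntegral_pow (hv : MomentsConverge v Γ) (n k : ℕ) (ϰ : Fin d → ℂ) (q : ℂ[X]) :
    weightedIntegral n v ϰ Γ q ⟨_, pow_mem_hPlus hv n k⟩ =
      momentLinear v ϰ Γ hv (X ^ (n + k) * q) := by
  rw [weightedIntegral_apply, momentLinear_apply]
  refine congrArg (contourIntegral ϰ Γ) (funext fun x => ?_)
  rw [eval_mul, eval_pow, eval_X, mul_comm (x ^ (n + k)), mul_assoc]

end WeightedIntegral

section KernelOperator

variable {d : ℕ} {Γ : Fin d → ℝ → ℂ} {u t : ℕ → ℂ}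

lemma cexp_neg_potential (u t : ℕ → ℂ) (x : ℂ) :
    Complex.exp (-potential d u x) =
      Complex.exp (-potential d (u + t) x) * Complex.exp (potential d t x) := by
  rw [← Complex.exp_add, potential_add, neg_add, neg_add_cancel_right]

variable (hu : MomentsConverge u Γ) (hut : MomentsConverge (u + t) Γ)

/-- The part `(e^{∑ t_J z^J/J} q(z))_{≥ n}` as an element of the completion of `H_+`. -/
def flowTail (n : ℕ) (q : ℂ[X]) : hPlus n (u + t) Γ :=
  ⟨tailPart n (flow d t fun z => q.eval z), by
    have hf := differentiable_flow d t q.differentiable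
    refine ⟨differentiable_tailPart n hf, fun j hj => ?_, fun k m => ?_⟩
    · rw [taylorCoeff_tailPart n (hf.analyticAt 0), if_pos hj]
    · refine ((hu (q * X ^ m) k).sub
        (hut (lowPart n (flow d t fun z => q.eval z) * X ^ m) k)).congr
        (Eventually.of_forall fun s => ?_)
      rw [tailPart_eq_sub_eval_lowPart]
      simp only [Pi.sub_apply, Polynomial.eval_mul, Polynomial.eval_pow, Polynomial.eval_X,
        flow, cexp_neg_potential u t]
      ring⟩

lemma weightedIntegral_flowTail (n : ℕ) (ϰ : Fin d → ℂ) (q r : ℂ[X]) :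
    weightedIntegral n (u + t) ϰ Γ q (flowTail hu hut n r) =
      momentLinear u ϰ Γ hu (q * r) -
        momentLinear (u + t) ϰ Γ hut (q * lowPart n (flow d t fun z => r.eval z)) := by
  rw [eq_sub_iff_add_eq, weightedIntegral_apply, momentLinear_apply, momentLinear_apply,
    ← contourIntegral_add ϰ (contourIntegrable_of_mem_hPlus (flowTail hu hut n r).2 q) (hut _)]
  refine congrArg (contourIntegral ϰ Γ) (funext fun x => ?_)
  simp only [flowTail, tailPart_eq_sub_eval_lowPart, Polynomial.eval_mul, flow,
    cexp_neg_potential u t]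
  ring

/-- The operator `K̂` with kernel `kernel d n p h t`, as the operator of finite rank
`f ↦ ∑_{j<n} (∫_{ϰΓ} e^{-V_{u+t}} p_j f) h_j⁻¹ (e^{∑ t_J z^J/J} p_j)_{≥ n}`. -/
def kernelOperator (n : ℕ) (ϰ : Fin d → ℂ) (p : ℕ → ℂ[X]) (h : ℕ → ℂ) :
    hPlus n (u + t) Γ →ₗ[ℂ] hPlus n (u + t) Γ :=
  finiteRankOperator (fun j : Fin n => weightedIntegral n (u + t) ϰ Γ (p j))
    fun j : Fin n => (h j)⁻¹ • flowTail hu hut n (p j)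

variable {n : ℕ} {ϰ : Fin d → ℂ} {p : ℕ → ℂ[X]} {h : ℕ → ℂ}

lemma kernelOperator_apply (f : hPlus n (u + t) Γ) :
    (kernelOperator hu hut n ϰ p h f : ℂ → ℂ) = fun z => ∑ j ∈ Finset.range n,
      (h j)⁻¹ * weightedIntegral n (u + t) ϰ Γ (p j) f *
        tailPart n (flow d t fun x => (p j).eval x) z := by
  funext z
  rw [kernelOperator, finiteRankOperator_apply, Finset.sum_range, Submodule.coe_sum,
    Finset.sum_apply]
  refine Finset.sum_congr rfl fun j _ => ?_
  simp only [Submodule.coe_smul, Pi.smul_apply, smul_eq_mul, flowTail]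
  ring

lemma kernelOperator_apply_eq_contourIntegral (f : hPlus n (u + t) Γ) (z : ℂ) :
    (kernelOperator hu hut n ϰ p h f : ℂ → ℂ) z = contourIntegral ϰ Γ fun w =>
      Complex.exp (-potential d u w) * kernel d n p h t z w * (f : ℂ → ℂ) w := by
  have hkernel : (fun w => Complex.exp (-potential d u w) * kernel d n p h t z w *
      (f : ℂ → ℂ) w) = fun w => ∑ j ∈ Finset.range n,
        ((h j)⁻¹ * tailPart n (flow d t fun x => (p j).eval x) z) *
          (Complex.exp (-potential d (u + t) w) * (p j).eval w * (f : ℂ → ℂ) w) := by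
    funext w
    rw [kernel, Finset.mul_sum, Finset.sum_mul]
    refine Finset.sum_congr rfl fun j _ => ?_
    rw [potential_add, neg_add, Complex.exp_add]
    ring
  rw [hkernel, contourIntegral_sum ϰ _ fun j _ =>
    (contourIntegrable_of_mem_hPlus f.2 (p j)).const_mul _, kernelOperator_apply]
  refine Finset.sum_congr rfl fun j _ => ?_
  rw [contourIntegral_const_mul, weightedIntegral_apply]
  ring

theorem fredholmDet_kernelOperator (H : IsOrthogonal (momentLinear u ϰ Γ hu) p h) :
    fredholmDet (kernelOperator hu hut n ϰ p h) =
      (hankel (momentFunctional (u + t) ϰ Γ) n).det / ∏ j ∈ Finset.range n, h j := by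
  let r : ℕ → ℂ[X] := fun j => lowPart n (flow d t fun z => (p j).eval z)
  have hmatrix : (1 - Matrix.of fun i j : Fin n => weightedIntegral n (u + t) ϰ Γ (p i)
      ((h j)⁻¹ • flowTail hu hut n (p j))) =
        (Matrix.of fun i j : Fin n => momentLinear (u + t) ϰ Γ hut (p i * r j)) *
          Matrix.diagonal fun j : Fin n => (h j)⁻¹ := by
    ext i j
    rw [Matrix.mul_diagonal, Matrix.sub_apply, Matrix.of_apply, Matrix.of_apply, map_smul,
      weightedIntegral_flowTail, H.orthogonal, Matrix.one_apply, smul_eq_mul]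
    rcases eq_or_ne i j with rfl | hij
    · rw [if_pos rfl, if_pos rfl, mul_sub, inv_mul_cancel₀ (H.h_ne_zero _), sub_sub_cancel,
        mul_comm]
    · rw [if_neg hij, if_neg (Fin.val_ne_iff.mpr hij), zero_sub, zero_sub, mul_neg, neg_neg,
        mul_comm]
  have hP : (Matrix.of fun k j : Fin n => (p j).coeff k).det = 1 :=
    Matrix.det_matrixOfPolynomials _ (fun j => H.natDegree_eq j) fun j => H.monic j
  rw [kernelOperator, fredholmDet_finiteRankOperator, hmatrix,
    of_linearMap_mul_eq_mul_hankel_mul _ (fun j => H.degree_lt j.2)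
      fun j => degree_lowPart_lt n _]
  simp only [Matrix.det_mul, Matrix.det_transpose, Matrix.det_diagonal, hP,
    det_coeff_lowPart_flow d t H.monic H.natDegree_eq, Finset.prod_inv_distrib, one_mul, mul_one]
  rw [Finset.prod_range, div_eq_mul_inv]
  rfl

lemma taylorCoeff_kernelOperator_pow (H : IsOrthogonal (momentLinear u ϰ Γ hu) p h) (i k : ℕ) :
    taylorCoeff (kernelOperator hu hut n ϰ p h ⟨_, pow_mem_hPlus hut n k⟩ : ℂ → ℂ) (n + i) =
      ∑ a ∈ Finset.range n, flowMatrix d t (n + i) a *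
        (christoffelDarboux (momentLinear (u + t) ϰ Γ hut) p h n (X ^ (n + k))).coeff a := by
  have hflow (j : ℕ) := differentiable_flow d t (p j).differentiable
  have htail (j : ℕ) := (differentiable_tailPart n (hflow j)).analyticAt 0
  rw [kernelOperator_apply, taylorCoeff_sum fun j _ => analyticAt_const.fun_mul (htail j)]
  simp only [christoffelDarboux_apply, Polynomial.finsetSum_coeff, Polynomial.coeff_smul,
    smul_eq_mul, Finset.mul_sum]
  rw [Finset.sum_comm]
  refine Finset.sum_congr rfl fun j hj => ?_
  rw [taylorCoeff_const_mul, taylorCoeff_tailPart n ((hflow j).analyticAt 0), if_neg (by omega),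
    taylorCoeff_flow_eval d t (H.degree_lt (Finset.mem_range.mp hj)), weightedIntegral_pow hut,
    Finset.mul_sum]
  exact Finset.sum_congr rfl fun a _ => by ring

theorem hasSum_taylorCoeff_kernelOperator_pow (H : IsOrthogonal (momentLinear u ϰ Γ hu) p h)
    (hL' : ∀ q : ℂ[X], HasSum
      (fun l => expCoeff d (-t) l * momentLinear u ϰ Γ hu (X ^ l * q))
      (momentLinear (u + t) ϰ Γ hut q)) (i k : ℕ) :
    HasSum (fun l => -∑ a ∈ Finset.range n, flowMatrix d t (n + i) a *
        (graphMatrix n p a l * triInv (plusBlock n (flowMatrix d t)) l k))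
      (taylorCoeff (kernelOperator hu hut n ϰ p h ⟨_, pow_mem_hPlus hut n k⟩ : ℂ → ℂ)
        (n + i)) := by
  have hentry := hasSum_sum (s := Finset.range n) fun a ha =>
    (H.hasSum_graphMatrix_mul_flowMatrix_neg hL' (Finset.mem_range.mp ha) (n + k)).mul_left
      (flowMatrix d t (n + i) a)
  have hvalue : -∑ a ∈ Finset.range n, flowMatrix d t (n + i) a * (flowMatrix d (-t) a (n + k) -
      (christoffelDarboux (momentLinear (u + t) ϰ Γ hut) p h n (X ^ (n + k))).coeff a) =
        taylorCoeff (kernelOperator hu hut n ϰ p h ⟨_, pow_mem_hPlus hut n k⟩ : ℂ → ℂ)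
          (n + i) := by
    rw [taylorCoeff_kernelOperator_pow hu hut H, ← Finset.sum_neg_distrib]
    refine Finset.sum_congr rfl fun a ha => ?_
    rw [flowMatrix_of_lt d (-t) (by have := Finset.mem_range.mp ha; omega), zero_sub, mul_neg,
      neg_neg]
  rw [← hvalue]
  simpa only [triInv_plusBlock_flowMatrix, flowMatrix_add_add] using hentry.neg

end KernelOperator

section PartitionRatio

namespace IsOrthogonal

variable {d : ℕ} {Γ : Fin d → ℝ → ℂ} {ϰ : Fin d → ℂ} {u v : ℕ → ℂ} {hu : MomentsConverge u Γ}
  {p : ℕ → ℂ[X]} {h : ℕ → ℂ} (H : IsOrthogonal (momentLinear u ϰ Γ hu) p h)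

include H

lemma partitionFunction_eq (n : ℕ) :
    partitionFunction n u ϰ Γ = n.factorial * ∏ j ∈ Finset.range n, h j := by
  rw [partitionFunction_eq_factorial_mul_det_hankel hu, ← H.det_hankel n]
  rfl

lemma partitionFunction_ne_zero (n : ℕ) : partitionFunction n u ϰ Γ ≠ 0 := by
  rw [H.partitionFunction_eq n]
  exact mul_ne_zero (Nat.cast_ne_zero.mpr n.factorial_ne_zero)
    (Finset.prod_ne_zero_iff.mpr fun j _ => H.h_ne_zero j)

lemma partitionFunction_div (hv : MomentsConverge v Γ) (n : ℕ) :
    partitionFunction n v ϰ Γ / partitionFunction n u ϰ Γ =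
      (hankel (momentFunctional v ϰ Γ) n).det / ∏ j ∈ Finset.range n, h j := by
  rw [H.partitionFunction_eq n, partitionFunction_eq_factorial_mul_det_hankel hv,
    mul_div_mul_left _ _ (Nat.cast_ne_zero.mpr n.factorial_ne_zero)]

end IsOrthogonal

end PartitionRatio

end KPTau

end

theorem mainTheorem5_general (d n : ℕ) (u : ℕ → ℂ) (ϰ : Fin d → ℂ) (Γ : Fin d → ℝ → ℂ)
    (cIn cOut : Fin d → ℂ) (hΓ : ∀ k, KPTau.IsAsymptoticCurve (Γ k) (cIn k) (cOut k))
    (hu : ∀ k, 0 < (u (d + 1) * cIn k ^ (d + 1)).re ∧ 0 < (u (d + 1) * cOut k ^ (d + 1)).re)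
    (p : ℕ → Polynomial ℂ) (h : ℕ → ℂ) (hp : KPTau.IsMonicOrthogonal u ϰ Γ p h) :
    KPTau.InGrassmannian n (KPTau.initialSubspace n p) ∧
    Function.Bijective (KPTau.projOn n (KPTau.initialSubspace n p)) ∧
    KPTau.IsAdmissibleFrame n (KPTau.initialSubspace n p) (fun j => p (n + j)) ∧
    (∀ σ : Fin n → Fin d, MeasureTheory.Integrable (KPTau.partitionIntegrand n u Γ σ)) ∧
    KPTau.partitionFunction n u ϰ Γ ≠ 0 ∧
    ∀ t : ℕ → ℂ,
      (∀ k, 0 < ((u + t) (d + 1) * cIn k ^ (d + 1)).re ∧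
        0 < ((u + t) (d + 1) * cOut k ^ (d + 1)).re) →
      (∀ σ : Fin n → Fin d, MeasureTheory.Integrable (KPTau.partitionIntegrand n (u + t) Γ σ)) ∧
      ∃ K : KPTau.hPlus n (u + t) Γ →ₗ[ℂ] KPTau.hPlus n (u + t) Γ,
        (∀ (f : KPTau.hPlus n (u + t) Γ) (z : ℂ),
          (K f : ℂ → ℂ) z = KPTau.contourIntegral ϰ Γ (fun w =>
            Complex.exp (-KPTau.potential d u w) * KPTau.kernel d n p h t z w *
              (f : ℂ → ℂ) w)) ∧
        Module.Finite ℂ (LinearMap.range K) ∧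
        Module.finrank ℂ (LinearMap.range K) ≤ n ∧
        KPTau.fredholmDet K =
          KPTau.partitionFunction n (u + t) ϰ Γ / KPTau.partitionFunction n u ϰ Γ ∧
        ((∀ k, ‖t (d + 1)‖ * ‖cIn k‖ ^ (d + 1) < (u (d + 1) * cIn k ^ (d + 1)).re ∧
            ‖t (d + 1)‖ * ‖cOut k‖ ^ (d + 1) < (u (d + 1) * cOut k ^ (d + 1)).re) →
          KPTau.IsKPTau d n (KPTau.initialSubspace n p) t
            (KPTau.partitionFunction n (u + t) ϰ Γ / KPTau.partitionFunction n u ϰ Γ) ∧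
          ∃ e : ℕ → KPTau.hPlus n (u + t) Γ,
            (∀ (k : ℕ) (z : ℂ), (e k : ℂ → ℂ) z = z ^ (n + k)) ∧
            ∀ i k : ℕ, HasSum (fun l : ℕ =>
              -∑ a ∈ Finset.range n, KPTau.flowMatrix d t (n + i) a *
                (KPTau.graphMatrix n p a l *
                  KPTau.triInv (KPTau.plusBlock n (KPTau.flowMatrix d t)) l k))
              (KPTau.taylorCoeff (K (e k) : ℂ → ℂ) (n + i))) := by
  have huc := KPTau.momentsConverge hΓ hu
  have H : KPTau.IsOrthogonal (KPTau.momentLinear u ϰ Γ huc) p h :=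
    ⟨hp.monic, hp.natDegree_eq, hp.h_ne_zero, hp.orthogonal⟩
  refine ⟨H.inGrassmannian n, H.projOn_bijective n, H.isAdmissibleFrame n,
    KPTau.integrable_partitionIntegrand huc n, H.partitionFunction_ne_zero n, fun t ht => ?_⟩
  have hut := KPTau.momentsConverge hΓ ht
  have hratio := H.partitionFunction_div hut n
  refine ⟨KPTau.integrable_partitionIntegrand hut n, KPTau.kernelOperator huc hut n ϰ p h,
    KPTau.kernelOperator_apply_eq_contourIntegral huc hut,
    KPTau.finite_range_finiteRankOperator _ _, KPTau.finrank_range_finiteRankOperator_le _ _,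
    (KPTau.fredholmDet_kernelOperator huc hut H).trans hratio.symm, fun hstrong => ?_⟩
  have hL' (q : Polynomial ℂ) := KPTau.hasSum_expCoeff_mul_momentFunctional hΓ hstrong ϰ q
  exact ⟨hratio ▸ H.isKPTau (L' := KPTau.momentLinear (u + t) ϰ Γ hut) hL' n,
    fun k => ⟨_, KPTau.pow_mem_hPlus hut n k⟩, fun _ _ => rfl,
    KPTau.hasSum_taylorCoeff_kernelOperator_pow huc hut H hL'⟩

theorem mainTheorem5 (d n : ℕ) (u : ℕ → ℂ) (hu : u (d + 1) ≠ 0)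
    (ϰ : Fin d → ℂ) (Γ : Fin d → ℝ → ℂ) (cIn cOut : Fin d → ℂ)
    (hΓ : KPTau.IsContourSystem d u Γ cIn cOut)
    (p : ℕ → Polynomial ℂ) (h : ℕ → ℂ) (hp : KPTau.IsMonicOrthogonal u ϰ Γ p h) :
    -- the initial subspace is a point of the Grassmannian, with admissible frame `p_n, p_{n+1}, …`
    KPTau.InGrassmannian n (KPTau.initialSubspace n p) ∧
    Function.Bijective (KPTau.projOn n (KPTau.initialSubspace n p)) ∧
    KPTau.IsAdmissibleFrame n (KPTau.initialSubspace n p) (fun j => p (n + j)) ∧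
    -- the initial partition function is a convergent integral and is nonzero
    (∀ σ : Fin n → Fin d, MeasureTheory.Integrable (KPTau.partitionIntegrand n u Γ σ)) ∧
    KPTau.partitionFunction n u ϰ Γ ≠ 0 ∧
    -- the Fredholm determinant, for all `t` for which `V + ∑ t_J x^J / J` grows along the contours
    ∀ t : ℕ → ℂ,
      (∀ k, 0 < ((u + t) (d + 1) * cIn k ^ (d + 1)).re ∧
        0 < ((u + t) (d + 1) * cOut k ^ (d + 1)).re) →
      (∀ σ : Fin n → Fin d, MeasureTheory.Integrable (KPTau.partitionIntegrand n (u + t) Γ σ)) ∧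
      ∃ K : KPTau.hPlus n (u + t) Γ →ₗ[ℂ] KPTau.hPlus n (u + t) Γ,
        (∀ (f : KPTau.hPlus n (u + t) Γ) (z : ℂ),
          (K f : ℂ → ℂ) z = KPTau.contourIntegral ϰ Γ (fun w =>
            Complex.exp (-KPTau.potential d u w) * KPTau.kernel d n p h t z w *
              (f : ℂ → ℂ) w)) ∧
        Module.Finite ℂ (LinearMap.range K) ∧
        Module.finrank ℂ (LinearMap.range K) ≤ n ∧
        KPTau.fredholmDet K =
          KPTau.partitionFunction n (u + t) ϰ Γ / KPTau.partitionFunction n u ϰ Γ ∧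
        -- the tau function, in the domain of convergence of the infinite determinant
        ((∀ k, ‖t (d + 1)‖ * ‖cIn k‖ ^ (d + 1) < (u (d + 1) * cIn k ^ (d + 1)).re ∧
            ‖t (d + 1)‖ * ‖cOut k‖ ^ (d + 1) < (u (d + 1) * cOut k ^ (d + 1)).re) →
          KPTau.IsKPTau d n (KPTau.initialSubspace n p) t
            (KPTau.partitionFunction n (u + t) ϰ Γ / KPTau.partitionFunction n u ϰ Γ) ∧
          -- `K` is represented by the matrix `-B W_{n+} W_+⁻¹ C⁻¹`
          ∃ e : ℕ → KPTau.hPlus n (u + t) Γ,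
            (∀ (k : ℕ) (z : ℂ), (e k : ℂ → ℂ) z = z ^ (n + k)) ∧
            ∀ i k : ℕ, HasSum (fun l : ℕ =>
              -∑ a ∈ Finset.range n, KPTau.flowMatrix d t (n + i) a *
                (KPTau.graphMatrix n p a l *
                  KPTau.triInv (KPTau.plusBlock n (KPTau.flowMatrix d t)) l k))
              (KPTau.taylorCoeff (K (e k) : ℂ → ℂ) (n + i))) := by
  exact mainTheorem5_general d n u ϰ Γ cIn cOut (hΓ.isAsymptoticCurve ·) (hΓ.re_mul_pow_pos hu ·)
    p h hp
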